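/- **Setting.** An *absolute plane* is a set of points with a family of distinguished sets of points (*lines*), a strict betweenness relation on points, and a congruence relation $AB\cong CD$ for pairs of points, such that: - (Incidence) two distinct points lie on exactly one line; each line has at least two points; there are three non-collinear points. - (Order) if $B$ is between $A$ and $C$, then $A,B,C$ are distinct and collinear and $B$ is between $C$ and $A$; of three distinct collinear points exactly one is between the other two; for $A\ne B$ there are a point between $A$ and $B$ and a point $X$ with $B$ between $A$ and $X$; the points off any line $l$ are partitioned into two nonempty convex sets, the *sides* of $l$, and a segment with ends on different sides of $l$ meets $l$. - (Segments) $\cong$ is an equivalence relation, $AB\cong BA$, and $AA\cong BC$ if and only if $B=C$; on every ray based at $O$ there is, for each segment $AB$, exactly one point $Y$ with $OY\cong AB$; sums of congruent segments are congruent; every segment has a midpoint. - (Triangle transport) if $A,B,C$ are non-collinear and $A'B'\cong AB$ with $A',B'$ on a line $l$, then on either side of $l$ there is a point $C'$ with $A'C'\cong AC$ and $B'C'\cong BC$. - (Right angles) If $ABC$ is a triangle with $AB\cong AC$ and $M$ is the midpoint of $BC$, the angles $AMB$ and $AMC$ (as pairs of rays) are called right. If $\angle BAC$ and $\angle EDF$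 are right angles with $AB\cong DE$ and $AC\cong DF$, then $BC\cong EF$. At most one angle of a triangle is a right angle. Two lines are *perpendicular* if they contain the diagonals of a rhombus whose diagonals have a common midpoint. An *ordered line* is a line with one of the two opposite linear orders of its points that induce betweenness. Fix an ordered line $\ell$, and let $T$ be the ordered abelian group of its congruence-preserving translations (order-preserving bijections of $\ell$ that preserve congruence), written additively and ordered by $s\le t$ iff $s(X)\le t(X)$ for all $X\in\ell$. The *magnitude* of a segment $AB$ with $A\neq B$ is the element $t>0$ of $T$ such that $X\,t(X)\cong AB$ for all $X\in\ell$. A *coordinatization* of an ordered line $l$ with zero at $O\in l$ is an order-preserving bijection from $T$ to $l$ that takes $0$ to $O$ and for which the magnitude of the segment joining the points with coordinates $s<t$ is $t-s$. A *system of axes* is an ordered pair $(l,m)$ of perpendicular ordered lines; each is coordinatized by $T$ with zero at the intersection point. The rectilinear coordinates of a point $P$ are the pair in $T\times T$ consisting of the coordinates of the feet of the perpendiculars from $P$ to $l$ and to $m$ (a point of an axis being its own foot on that axis). **Proposition.** In every absolute plane, and for every choice of $\ell$, each point has exactly one pair of rectilinear coordinates with respect to any given system of axes, and the set of all pairs in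 $T\times T$ that are the rectilinear coordinates of some point is the same for every system of axes. -/

import Mathlib

universe u

/-- The primitive notions of plane geometry: straight lines (as sets of points), strict
betweenness, and congruence of segments (`Cong A B C D` says that `AB` is congruent to `CD`). -/
class PlaneGeometry (P : Type u) where
  lines : Set (Set P)
  Btw : P → P → P → Prop
  Cong : P → P → P → P → Prop

namespace PlaneGeometry

variable {P : Type u} [PlaneGeometry P]

/-- `A`, `B`, `C` lie on a common line. -/
def Collinear (A B C : P) : Prop :=
  ∃ l ∈ lines (P := P), A ∈ l ∧ B ∈ l ∧ C ∈ l

/-- The ray based at `O` through `A` (including `O`), for `A ≠ O`. -/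
def ray (O A : P) : Set P :=
  {X | X = O ∨ X = A ∨ Btw O X A ∨ Btw O A X}

/-- `C` and `D` are off the line `l` and on the same side of it: no point of `l` separates them. -/
def SameSide (l : Set P) (C D : P) : Prop :=
  C ∉ l ∧ D ∉ l ∧ ∀ X ∈ l, ¬ Btw C X D

/-- `M` is the midpoint of the segment `AB`. -/
def IsMidpoint (M A B : P) : Prop :=
  Btw A M B ∧ Cong A M M B

/-- The angle with sides `ray M A`, `ray M B` is one of two paired right angles at `M` along
the line `MB`: there is an isosceles triangle with apex on `ray M A`, with one end of its base on
`ray M B`, and whose base has midpoint `M`. -/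
def IsPairedRight (A M B : P) : Prop :=
  ∃ A' ∈ ray M A, ∃ B' ∈ ray M B, ∃ C' : P,
    ¬ Collinear A' B' C' ∧ IsMidpoint M B' C' ∧ Cong A' B' A' C'

/-- The angle with vertex `M` and sides `ray M A`, `ray M B` is a right angle: it belongs to a pair
of right angles along the line of at least one of its two sides. -/
def IsRightAngle (A M B : P) : Prop :=
  IsPairedRight A M B ∨ IsPairedRight B M A

/-- Two lines are perpendicular if they contain the two diagonals of a rhombus `ABDC` whose
diagonals `AD` and `BC` have the same midpoint. -/
def Perp (l m : Set P) : Prop :=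
  l ∈ lines (P := P) ∧ m ∈ lines (P := P) ∧
    ∃ M A B C D : P, A ∈ l ∧ D ∈ l ∧ B ∈ m ∧ C ∈ m ∧ ¬ Collinear A B C ∧
      IsMidpoint M A D ∧ IsMidpoint M B C ∧
      Cong A B A C ∧ Cong A B D B ∧ Cong A B D C

/-- `F` is the foot of the perpendicular from `A` to `l` (which is `A` itself if `A ∈ l`). -/
def IsFoot (A : P) (l : Set P) (F : P) : Prop :=
  F ∈ l ∧ ∃ n : Set P, Perp l n ∧ A ∈ n ∧ F ∈ n

end PlaneGeometry

open PlaneGeometry in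
/-- Planar absolute geometry: incidence, order with plane separation, segment congruence
with segment arithmetic, midpoints, transport of triangles, and two axioms on right angles. -/
class AbsolutePlane (P : Type u) extends PlaneGeometry P where
  -- incidence
  existsUnique_line : ∀ A B : P, A ≠ B → ∃! l : Set P, l ∈ lines ∧ A ∈ l ∧ B ∈ l
  two_points : ∀ l ∈ lines, ∃ A ∈ l, ∃ B ∈ l, A ≠ B
  three_points : ∃ A B C : P, ¬ Collinear A B C
  -- order
  btw_distinct : ∀ A B C : P, Btw A B C → A ≠ B ∧ B ≠ C ∧ A ≠ C
  btw_collinear : ∀ A B C : P, Btw A B C → Collinear A B C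
  btw_symm : ∀ A B C : P, Btw A B C → Btw C B A
  btw_total : ∀ A B C : P, A ≠ B → B ≠ C → A ≠ C → Collinear A B C →
    Btw A B C ∨ Btw B C A ∨ Btw C A B
  btw_unique : ∀ A B C : P, Btw A B C → ¬ Btw B C A
  btw_inner : ∀ A B : P, A ≠ B → ∃ X, Btw A X B
  btw_extend : ∀ A B : P, A ≠ B → ∃ X, Btw A B X
  /-- Each line separates the plane into two convex sides. -/
  plane_separation : ∀ l ∈ lines, ∃ H K : Set P,
    H.Nonempty ∧ K.Nonempty ∧ Disjoint H K ∧ H ∪ K = lᶜ ∧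
    (∀ A ∈ H, ∀ B ∈ H, ∀ X, Btw A X B → X ∈ H) ∧
    (∀ A ∈ K, ∀ B ∈ K, ∀ X, Btw A X B → X ∈ K) ∧
    (∀ A ∈ H, ∀ B ∈ K, ∃ X ∈ l, Btw A X B)
  -- congruence of segments; a degenerate segment is congruent to the degenerate ones only
  cong_refl : ∀ A B : P, Cong A B A B
  cong_symm : ∀ A B C D : P, Cong A B C D → Cong C D A B
  cong_trans : ∀ A B C D E F : P, Cong A B C D → Cong C D E F → Cong A B E F
  cong_swap : ∀ A B : P, Cong A B B A
  cong_degenerate : ∀ A B C : P, Cong A A B C ↔ B = C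
  /-- Segments can be transported uniquely to any ray. -/
  segment_transport : ∀ O X A B : P, O ≠ X → ∃! Y, Y ∈ ray O X ∧ Cong O Y A B
  /-- If equals are added to equals, the wholes are equal. -/
  cong_add : ∀ A B C A' B' C' : P, Btw A B C → Btw A' B' C' →
    Cong A B A' B' → Cong B C B' C' → Cong A C A' C'
  exists_midpoint : ∀ A B : P, A ≠ B → ∃ M, IsMidpoint M A B
  /-- A triangle can be transported to any congruent base, on either side of its line. -/
  triangle_transport : ∀ A B C A' B' : P, ¬ Collinear A B C → Cong A' B' A B →
    ∀ l ∈ lines, A' ∈ l → B' ∈ l → ∀ D : P, D ∉ l →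
      ∃ C', SameSide l C' D ∧ Cong A' C' A C ∧ Cong B' C' B C
  /-- The legs of a right angle determine the hypotenuse. -/
  right_angles_equal : ∀ A B C D E F : P, IsRightAngle B A C → IsRightAngle E D F →
    Cong A B D E → Cong A C D F → Cong B C E F
  /-- At most one angle of a triangle is a right angle. -/
  right_angle_unique : ∀ A B C : P, ¬ Collinear A B C →
    ¬ (IsRightAngle B A C ∧ IsRightAngle A B C)

namespace AbsolutePlane

open PlaneGeometry

/-- An ordered line: a line with one of the two opposite linear orders that induce the
betweenness of its points. -/
structure OrderedLine (P : Type u) [PlaneGeometry P] where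
  carrier : Set P
  isLine : carrier ∈ lines (P := P)
  order : LinearOrder carrier
  btw_iff : ∀ A B C : carrier,
    Btw (A : P) (B : P) (C : P) ↔ (A < B ∧ B < C) ∨ (C < B ∧ B < A)

instance {P : Type u} [PlaneGeometry P] (ℓ : OrderedLine P) : LinearOrder ℓ.carrier := ℓ.order

variable {P : Type u} [AbsolutePlane P]

/-- The congruence-preserving translations of an ordered line: the order-preserving
bijections of the line to itself that preserve congruence of segments with their images. -/
def translations (ℓ : OrderedLine P) : Subgroup (ℓ.carrier ≃o ℓ.carrier) where
  carrier := {σ | ∀ A B : ℓ.carrier, Cong (A : P) (B : P) (σ A : P) (σ B : P)}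
  one_mem' := fun A B => cong_refl (A : P) (B : P)
  mul_mem' := fun {σ τ} hσ hτ A B => cong_trans _ _ _ _ _ _ (hτ A B) (hσ (τ A) (τ B))
  inv_mem' := fun {σ} hσ A B => by
    have h := hσ (σ⁻¹ A) (σ⁻¹ B)
    have e : ∀ X, σ (σ⁻¹ X) = X := fun X => σ.apply_symm_apply X
    rw [e, e] at h
    exact cong_symm _ _ _ _ h

/-- The group `T` of signed magnitudes determined by a reference ordered line: its translations,
written additively. -/
def SignedMag (ℓ : OrderedLine P) : Type u := Additive (translations ℓ)

instance (ℓ : OrderedLine P) : AddGroup (SignedMag ℓ) :=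
  inferInstanceAs (AddGroup (Additive (translations ℓ)))

/-- The action of a translation on the points of the reference line. -/
def SignedMag.act {ℓ : OrderedLine P} (t : SignedMag ℓ) (X : ℓ.carrier) : ℓ.carrier :=
  (Additive.toMul (t : Additive (translations ℓ))).1 X

/-- Translations are ordered by how far they move the points. -/
instance (ℓ : OrderedLine P) : PartialOrder (SignedMag ℓ) where
  le s t := ∀ X, s.act X ≤ t.act X
  le_refl _ _ := le_rfl
  le_trans _ _ _ h₁ h₂ X := (h₁ X).trans (h₂ X)
  le_antisymm _ _ h₁ h₂ :=
    Subtype.ext (DFunLike.ext _ _ fun X => le_antisymm (h₁ X) (h₂ X))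

/-- `t` is the magnitude of the segment `AB`: the positive translation whose displacement of the
points of the reference line is congruent to `AB`. -/
def IsMagnitude {ℓ : OrderedLine P} (A B : P) (t : SignedMag ℓ) : Prop :=
  0 < t ∧ ∀ X : ℓ.carrier, Cong (X : P) (t.act X : P) A B

/-- A coordinatization by `T` of an ordered line `l` with zero at `O`: an order-preserving
bijection that maps `0` to `O` and for which magnitudes of segments of `l` are differences of
coordinates. -/
structure Coordinatization (ℓ l : OrderedLine P) (O : P) where
  toPoint : SignedMag ℓ ≃o l.carrier
  map_zero : (toPoint 0 : P) = O
  magnitude : ∀ s t : SignedMag ℓ, s < t →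
    IsMagnitude (toPoint s : P) (toPoint t : P) (t - s)

/-- A system of axes: an ordered pair of perpendicular ordered lines, meeting at `origin`. -/
structure Axes (P : Type u) [AbsolutePlane P] where
  l : OrderedLine P
  m : OrderedLine P
  perp : Perp l.carrier m.carrier
  origin : P
  origin_mem_l : origin ∈ l.carrier
  origin_mem_m : origin ∈ m.carrier

/-- The pair `p` consists of the rectilinear coordinates of the point `A`: its members are the
coordinates of the feet of the perpendiculars from `A` to the two axes. -/
def Axes.HasCoords (ℓ : OrderedLine P) (S : Axes P) (A : P)
    (p : SignedMag ℓ × SignedMag ℓ) : Prop :=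
  ∃ (c : Coordinatization ℓ S.l S.origin) (d : Coordinatization ℓ S.m S.origin),
    IsFoot A S.l.carrier (c.toPoint p.1 : P) ∧ IsFoot A S.m.carrier (d.toPoint p.2 : P)

/-- The set of pairs in `T × T` that correspond to points of the plane. -/
def Axes.coordSet (ℓ : OrderedLine P) (S : Axes P) : Set (SignedMag ℓ × SignedMag ℓ) :=
  {p | ∃ A : P, S.HasCoords ℓ A p}

end AbsolutePlane

/-! Without a parallel postulate, perpendiculars erected at a point `F` of one axis and a point `G`
of the other need not meet, so not every pair in `T × T` need occur. The point is that whether they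
meet depends only on the lengths of `OF` and `OG`, where `O` is the origin. If `A` has feet `F` and
`G` other than `O`, then `OFAG` has right angles at `O`, `F` and `G`, and its diagonals cross at
some `Z` (`exists_diagonal_point`). This crossing describes `A` by data that can be copied:
reproduce the right triangle `OFG` as `O'F'G'`, mark `Z'` on `F'G'`, and prolong `O'Z'` by the
length of `ZA` to `A'`. Then `five_segment` gives the distances from `A'` to `F'` and `G'`, and
`Orth.of_len` makes the angles at `F'` and `G'` right (`exists_isFoot_of_len`).

The five-segment property replaces the missing side-angle-side axiom. It comes from `len_isometry`:
drop a perpendicular, copy it to the other line, and use that a side and two distances determine a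
point (`eq_of_sameSide`). Underneath lies the symmetry and uniqueness of perpendiculars, both drawn
from `btw_midpoint_of_rhombus`, where a failure would produce a triangle with two right angles.

As for the coordinates themselves, any two ordered lines are isometric (`exists_isometry`) and
translations act simply transitively on `ℓ`. So `T` is a copy of `ℓ`, and an axis has exactly one
coordinatization with a given zero. Feet of perpendiculars exist and are unique, which gives one
pair per point. -/

open PlaneGeometry

namespace AbsolutePlane

variable {P : Type*} [AbsolutePlane P]

/-! ### Lengths of segments -/

/-- The length of a segment: its congruence class. -/
def len (A B : P) : Set (P × P) := {p | Cong A B p.1 p.2}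

theorem cong_iff {A B C D : P} : Cong A B C D ↔ len A B = len C D := by
  constructor
  · intro h
    ext p
    exact ⟨fun hp => cong_trans _ _ _ _ _ _ (cong_symm _ _ _ _ h) hp,
      fun hp => cong_trans _ _ _ _ _ _ h hp⟩
  · intro h
    have : (C, D) ∈ len C D := cong_refl C D
    rw [← h] at this
    exact this

theorem len_comm (A B : P) : len A B = len B A := cong_iff.1 (cong_swap A B)

theorem eq_of_len_self {A B C : P} (h : len A A = len B C) : B = C :=
  (cong_degenerate A B C).1 (cong_iff.2 h)

theorem len_self (A B : P) : len A A = len B B := cong_iff.1 ((cong_degenerate A B B).2 rfl)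

theorem len_ne {A B C D : P} (h : len A B = len C D) (hAB : A ≠ B) : C ≠ D := by
  rintro rfl
  exact hAB (eq_of_len_self h.symm)

theorem len_add {A B C A' B' C' : P} (h : Btw A B C) (h' : Btw A' B' C')
    (h₁ : len A B = len A' B') (h₂ : len B C = len B' C') : len A C = len A' C' :=
  cong_iff.1 (cong_add _ _ _ _ _ _ h h' (cong_iff.2 h₁) (cong_iff.2 h₂))

theorem isMidpoint_iff {M A B : P} : IsMidpoint M A B ↔ Btw A M B ∧ len M A = len M B := by
  unfold IsMidpoint
  rw [cong_iff, len_comm A M]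

/-! ### Incidence -/

theorem line_eq {l m : Set P} (hl : l ∈ lines) (hm : m ∈ lines) {A B : P} (h : A ≠ B)
    (hAl : A ∈ l) (hBl : B ∈ l) (hAm : A ∈ m) (hBm : B ∈ m) : l = m :=
  (existsUnique_line A B h).unique ⟨hl, hAl, hBl⟩ ⟨hm, hAm, hBm⟩

theorem exists_line {A B : P} (h : A ≠ B) : ∃ l ∈ lines (P := P), A ∈ l ∧ B ∈ l :=
  (existsUnique_line A B h).exists

theorem not_collinear {l : Set P} (hl : l ∈ lines) {A B C : P} (h : A ≠ B)
    (hA : A ∈ l) (hB : B ∈ l) (hC : C ∉ l) : ¬ PlaneGeometry.Collinear A B C := by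
  rintro ⟨m, hm, hAm, hBm, hCm⟩
  exact hC (line_eq hl hm h hA hB hAm hBm ▸ hCm)

theorem mem_of_btw_right {l : Set P} (hl : l ∈ lines) {A B C : P} (h : Btw A B C)
    (hA : A ∈ l) (hB : B ∈ l) : C ∈ l := by
  obtain ⟨m, hm, hAm, hBm, hCm⟩ := btw_collinear _ _ _ h
  exact line_eq hl hm (btw_distinct _ _ _ h).1 hA hB hAm hBm ▸ hCm

theorem mem_of_btw_mid {l : Set P} (hl : l ∈ lines) {A B C : P} (h : Btw A B C)
    (hA : A ∈ l) (hC : C ∈ l) : B ∈ l := by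
  obtain ⟨m, hm, hAm, hBm, hCm⟩ := btw_collinear _ _ _ h
  exact line_eq hl hm (btw_distinct _ _ _ h).2.2 hA hC hAm hCm ▸ hBm

theorem exists_ne_mem {l : Set P} (hl : l ∈ lines) (A : P) : ∃ B ∈ l, B ≠ A := by
  obtain ⟨B, hB, C, hC, h⟩ := two_points l hl
  by_cases hBA : B = A
  · exact ⟨C, hC, fun hCA => h (hBA.trans hCA.symm)⟩
  · exact ⟨B, hB, hBA⟩

theorem btw_total_of_mem {l : Set P} (hl : l ∈ lines) {A B C : P} (hA : A ∈ l) (hB : B ∈ l)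
    (hC : C ∈ l) (hAB : A ≠ B) (hBC : B ≠ C) (hAC : A ≠ C) :
    Btw A B C ∨ Btw B C A ∨ Btw C A B :=
  btw_total A B C hAB hBC hAC ⟨l, hl, hA, hB, hC⟩

/-! ### Sides of a line -/

/-- Encoding the sides by a predicate `f` reduces arguments about crossings to propositional logic,
which is how `tauto` closes them later. -/
theorem exists_side {l : Set P} (hl : l ∈ lines) : ∃ f : P → Prop,
    (∃ A, A ∉ l ∧ f A) ∧ (∃ A, A ∉ l ∧ ¬ f A) ∧
      ∀ A, A ∉ l → ∀ B, B ∉ l → ((∃ X ∈ l, Btw A X B) ↔ ¬ (f A ↔ f B)) := by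
  obtain ⟨H, K, ⟨a, ha⟩, ⟨b, hb⟩, hd, hu, hH, hK, hHK⟩ := plane_separation l hl
  have hHl : ∀ A ∈ H, A ∉ l := fun A hA => by
    have : A ∈ H ∪ K := Or.inl hA
    rw [hu] at this; exact this
  have hKl : ∀ A ∈ K, A ∉ l := fun A hA => by
    have : A ∈ H ∪ K := Or.inr hA
    rw [hu] at this; exact this
  have hnot : ∀ A ∈ K, A ∉ H := fun A hA hA' => Set.disjoint_left.1 hd hA' hA
  have hor : ∀ A, A ∉ l → A ∈ H ∨ A ∈ K := fun A hA => by
    have : A ∈ lᶜ := hA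
    rw [← hu] at this; exact this
  refine ⟨(· ∈ H), ⟨a, hHl a ha, ha⟩, ⟨b, hKl b hb, hnot b hb⟩, fun A hA B hB => ?_⟩
  rcases hor A hA with h | h <;> rcases hor B hB with h' | h'
  · simp only [h, h', not_true, iff_false]
    rintro ⟨X, hX, hX'⟩
    exact hHl X (hH A h B h' X hX') hX
  · simp only [h, hnot B h', iff_false, not_true, not_false_iff, iff_true]
    exact hHK A h B h'
  · simp only [hnot A h, h', iff_true, not_false_iff]
    obtain ⟨X, hX, hX'⟩ := hHK B h' A h
    exact ⟨X, hX, btw_symm _ _ _ hX'⟩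
  · simp only [hnot A h, hnot B h', not_true, iff_false]
    rintro ⟨X, hX, hX'⟩
    exact hKl X (hK A h B h' X hX') hX

theorem exists_not_mem {l : Set P} (hl : l ∈ lines) : ∃ A, A ∉ l := by
  obtain ⟨f, ⟨A, hA, -⟩, -⟩ := exists_side hl
  exact ⟨A, hA⟩

/-- A point of a line divides the other points of the line into two classes. -/
theorem exists_ray_side {l : Set P} (hl : l ∈ lines) {O : P} (hO : O ∈ l) : ∃ f : P → Prop,
    ∀ A ∈ l, A ≠ O → ∀ B ∈ l, B ≠ O → (Btw A O B ↔ ¬ (f A ↔ f B)) := by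
  -- A second line `n` through `O` meets `l` only there, so the sides of `n` cut out the two rays of
  -- `l`.
  obtain ⟨D, hD⟩ := exists_not_mem hl
  have hOD : O ≠ D := fun h => hD (h ▸ hO)
  obtain ⟨n, hn, hOn, hDn⟩ := exists_line hOD
  have hint : ∀ A ∈ l, A ≠ O → A ∉ n := fun A hA hAO hAn =>
    hD (line_eq hl hn hAO hA hO hAn hOn ▸ hDn)
  obtain ⟨f, -, -, hf⟩ := exists_side hn
  refine ⟨f, fun A hA hAO B hB hBO => ?_⟩
  rw [← hf A (hint A hA hAO) B (hint B hB hBO)]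
  refine ⟨fun h => ⟨O, hOn, h⟩, ?_⟩
  rintro ⟨X, hX, h⟩
  have hXl := mem_of_btw_mid hl h hA hB
  by_cases hXO : X = O
  · exact hXO ▸ h
  · exact absurd hX (hint X hXl hXO)

/-! ### Linear orders from betweenness -/

/-- An order is a coherent choice, at each point, of which of its two classes comes after it. At `O`
it is the class of `A`; at any other `X` it is the class without `O` if `X` comes after `O`, and the
class of `O` otherwise. -/
theorem exists_linearOrder_of_btw {L : Type*} (b : L → L → L → Prop)
    (hd : ∀ A B C, b A B C → A ≠ B ∧ B ≠ C ∧ A ≠ C) (hs : ∀ A B C, b A B C → b C B A)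
    (ht : ∀ A B C, A ≠ B → B ≠ C → A ≠ C → b A B C ∨ b B C A ∨ b C A B)
    (hu : ∀ A B C, b A B C → ¬ b B C A)
    (hp : ∀ O, ∃ f : L → Prop, ∀ A B, A ≠ O → B ≠ O → (b A O B ↔ ¬ (f A ↔ f B)))
    (O A : L) (hOA : O ≠ A) :
    ∃ o : LinearOrder L, o.lt O A ∧
      ∀ X Y Z, b X Y Z ↔ (o.lt X Y ∧ o.lt Y Z) ∨ (o.lt Z Y ∧ o.lt Y X) := by
  classical
  choose f hf using hp
  -- `g X` says that `X` lies on the ray of `A` from `O`; `u X Y` says that `Y` comes after `X`.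
  let g : L → Prop := fun X => (f O X ↔ f O A)
  let u : L → L → Prop := fun X Y => if X = O then g Y else (f X Y ↔ (f X O ↔ ¬ g X))
  have hup : ∀ X Y Z, Y ≠ X → Z ≠ X → (b Y X Z ↔ ¬ (u X Y ↔ u X Z)) := by
    intro X Y Z hY hZ
    rw [hf X Y Z hY hZ]
    simp only [u, g]
    split_ifs with h
    · subst h; tauto
    · tauto
  have hO : ∀ X, X ≠ O → (u X O ↔ ¬ u O X) := by
    intro X hX
    simp only [u, if_neg hX, if_true]
    tauto
  have hOA' : u O A := by simp [u, g]
  have hxy : ∀ X Y, X ≠ Y → (u X Y ↔ ¬ u Y X) := by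
    intro X Y h
    by_cases hX : X = O
    · subst hX
      have := hO Y (Ne.symm h); tauto
    by_cases hY : Y = O
    · subst hY
      exact hO X h
    have h1 := hO X hX
    have h2 := hO Y hY
    have h3 := hup O X Y hX hY
    have h4 := hup X O Y (Ne.symm hX) (Ne.symm h)
    have h5 := hup Y O X (Ne.symm hY) h
    have h7 := hu X O Y
    have h8 := hu O Y X
    have h9 := hu Y X O
    have h10 : b O X Y ↔ b Y X O := ⟨hs _ _ _, hs _ _ _⟩
    rcases ht X O Y hX (Ne.symm hY) h with h6 | h6 | h6
    · have h11 : ¬ b Y X O := fun k => h9 k h6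
      have h12 : ¬ b O Y X := h7 h6
      rw [h10] at h4
      clear h7 h8 h9 h10 hd hs ht hu hf hO hup
      clear_value u
      tauto
    · have h11 : ¬ b Y X O := h8 h6
      have h12 : ¬ b X O Y := fun k => h7 k h6
      rw [h10] at h4
      clear h7 h8 h9 h10 hd hs ht hu hf hO hup
      clear_value u
      tauto
    · have h11 : ¬ b X O Y := h9 h6
      have h12 : ¬ b O Y X := fun k => h8 k h6
      rw [h10] at h4
      clear h7 h8 h9 h10 hd hs ht hu hf hO hup
      clear_value u
      tauto
  clear_value u
  have htr : ∀ X Y Z, X ≠ Y → u X Y → Y ≠ Z → u Y Z → X ≠ Z ∧ u X Z := by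
    intro X Y Z h1 h2 h3 h4
    have h5 := (hxy X Y h1).1 h2
    have h6 : X ≠ Z := by rintro rfl; exact h5 h4
    have h7 := (hup Y X Z h1 h3.symm).2 (by tauto)
    have h8 : ¬ b Y X Z := fun h => hu _ _ _ (hs _ _ _ h7) h
    have h9 := hup X Y Z h1.symm h6.symm
    clear hup hxy hd hs ht hu hf hO
    exact ⟨h6, by tauto⟩
  let o : LinearOrder L :=
    { le := fun X Y => X = Y ∨ u X Y
      lt := fun X Y => X ≠ Y ∧ u X Y
      le_refl := fun X => Or.inl rfl
      le_trans := by
        intro X Y Z h1 h2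
        by_cases h3 : X = Y
        · subst h3; exact h2
        by_cases h4 : Y = Z
        · subst h4; exact h1
        exact Or.inr (htr X Y Z h3 (h1.resolve_left h3) h4 (h2.resolve_left h4)).2
      le_antisymm := by
        intro X Y h1 h2
        by_contra h
        have := hxy X Y h
        have := h1.resolve_left h
        have := h2.resolve_left (Ne.symm h)
        tauto
      le_total := by
        intro X Y
        by_cases h : X = Y
        · exact Or.inl (Or.inl h)
        · have := hxy X Y h
          tauto
      lt_iff_le_not_ge := by
        intro X Y
        by_cases h : X = Y
        · simp [h]
        · have := hxy X Y h
          have := Ne.symm h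
          tauto
      toDecidableLE := Classical.decRel _ }
  refine ⟨o, ⟨hOA, hOA'⟩, fun X Y Z => ?_⟩
  change _ ↔ ((X ≠ Y ∧ u X Y) ∧ (Y ≠ Z ∧ u Y Z)) ∨ ((Z ≠ Y ∧ u Z Y) ∧ (Y ≠ X ∧ u Y X))
  by_cases h1 : X = Y
  · have := hd X Y Z; tauto
  by_cases h2 : Y = Z
  · have := hd X Y Z
    have := Ne.symm h1
    subst h2; tauto
  have h3 := hxy X Y h1
  have h4 := hxy Y Z h2
  have h5 := hup Y X Z h1 (Ne.symm h2)
  have := Ne.symm h1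
  have := Ne.symm h2
  tauto

/-- Every line can be ordered, in the direction of any two of its points. -/
theorem exists_orderedLine {l : Set P} (hl : l ∈ lines) {O A : P} (hO : O ∈ l) (hA : A ∈ l)
    (h : O ≠ A) : ∃ (L : OrderedLine P) (o a : L.carrier),
      L.carrier = l ∧ (o : P) = O ∧ (a : P) = A ∧ o < a := by
  obtain ⟨o, h1, h2⟩ := exists_linearOrder_of_btw (L := l)
    (fun A B C => Btw (A : P) (B : P) (C : P))
    (fun A B C h => by
      have := btw_distinct _ _ _ h
      simpa only [ne_eq, Subtype.ext_iff] using this)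
    (fun A B C h => btw_symm _ _ _ h)
    (fun A B C h1 h2 h3 => btw_total_of_mem hl A.2 B.2 C.2 (fun e => h1 (Subtype.ext e))
      (fun e => h2 (Subtype.ext e)) (fun e => h3 (Subtype.ext e)))
    (fun A B C h => btw_unique _ _ _ h)
    (fun O => by
      obtain ⟨f, hf⟩ := exists_ray_side hl O.2
      exact ⟨fun X => f X, fun A B hA hB => hf A A.2 (fun e => hA (Subtype.ext e)) B B.2
        (fun e => hB (Subtype.ext e))⟩)
    ⟨O, hO⟩ ⟨A, hA⟩ (fun e => h (congrArg Subtype.val e))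
  exact ⟨⟨l, hl, o, h2⟩, ⟨O, hO⟩, ⟨A, hA⟩, rfl, rfl, rfl, h1⟩

/-! ### Transport of segments -/

theorem mem_ray_of {l : Set P} (hl : l ∈ lines) {O X Y : P} (hO : O ∈ l) (hX : X ∈ l)
    (hY : Y ∈ l) (hXO : X ≠ O) (h : ¬ Btw X O Y) : Y ∈ ray O X := by
  by_cases hYO : Y = O
  · exact Or.inl hYO
  by_cases hYX : Y = X
  · exact Or.inr (Or.inl hYX)
  rcases btw_total_of_mem hl hX hO hY hXO (Ne.symm hYO) (Ne.symm hYX) with h' | h' | h'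
  · exact absurd h' h
  · exact Or.inr (Or.inr (Or.inl h'))
  · exact Or.inr (Or.inr (Or.inr (btw_symm _ _ _ h')))

theorem eq_or_btw_of_len {l : Set P} (hl : l ∈ lines) {O X Y : P} (hO : O ∈ l) (hX : X ∈ l)
    (hY : Y ∈ l) (h : len O X = len O Y) : X = Y ∨ Btw X O Y := by
  by_cases hXO : X = O
  · subst hXO
    exact Or.inl (eq_of_len_self h)
  by_contra! hc
  exact hc.1 ((segment_transport O X O X (Ne.symm hXO)).unique
    ⟨Or.inr (Or.inl rfl), cong_refl _ _⟩
    ⟨mem_ray_of hl hO hX hY hXO hc.2, cong_iff.2 h.symm⟩)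

theorem exists_btw_len {X O A B : P} (h : X ≠ O) (hAB : A ≠ B) :
    ∃ Y, Btw X O Y ∧ len O Y = len A B := by
  obtain ⟨Z, hZ⟩ := btw_extend X O h
  have hZ' := btw_distinct _ _ _ hZ
  obtain ⟨l, hl, hXl, hOl⟩ := exists_line h
  have hZl := mem_of_btw_right hl hZ hXl hOl
  obtain ⟨Y, ⟨hY, hY'⟩, -⟩ := segment_transport O Z A B hZ'.2.1
  have hYO : Y ≠ O := (len_ne (cong_iff.1 hY').symm hAB).symm
  refine ⟨Y, ?_, cong_iff.1 hY'⟩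
  have hYl : Y ∈ l := by
    rcases hY with rfl | rfl | hY | hY
    · exact hOl
    · exact hZl
    · exact mem_of_btw_mid hl hY hOl hZl
    · exact mem_of_btw_right hl hY hOl hZl
  obtain ⟨f, hf⟩ := exists_ray_side hl hOl
  have h1 := (hf X hXl h Z hZl hZ'.2.1.symm).1 hZ
  have h2 := hf Z hZl hZ'.2.1.symm Y hYl hYO
  have h3 : ¬ Btw Z O Y := by
    intro k
    rcases hY with rfl | rfl | hY | hY
    · exact hYO rfl
    · exact (btw_distinct _ _ _ k).2.2 rfl
    · exact btw_unique _ _ _ k hY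
    · exact btw_unique _ _ _ (btw_symm _ _ _ k) hY
  exact (hf X hXl h Y hYl hYO).2 (by tauto)

theorem exists_same_ray_len {l : Set P} (hl : l ∈ lines) {O X A B : P} (hO : O ∈ l) (hX : X ∈ l)
    (hXO : X ≠ O) (hAB : A ≠ B) :
    ∃ Y ∈ l, Y ≠ O ∧ ¬ Btw X O Y ∧ len O Y = len A B := by
  obtain ⟨Z, hZ⟩ := btw_extend X O hXO
  have hZ' := btw_distinct _ _ _ hZ
  have hZl := mem_of_btw_right hl hZ hX hO
  obtain ⟨Y, hY, hY'⟩ := exists_btw_len hZ'.2.1.symm hAB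
  have hYl := mem_of_btw_right hl hY hZl hO
  have hYO := (btw_distinct _ _ _ hY).2.1.symm
  refine ⟨Y, hYl, hYO, ?_, hY'⟩
  obtain ⟨f, hf⟩ := exists_ray_side hl hO
  have h1 := hf X hX hXO Z hZl hZ'.2.1.symm
  have h2 := hf Z hZl hZ'.2.1.symm Y hYl hYO
  have h3 := hf X hX hXO Y hYl hYO
  tauto

/-! ### Segments of an ordered line -/

namespace OrderedLine

variable {L L' : OrderedLine P}

theorem btw_of_lt {a b c : L.carrier} (h : a < b) (h' : b < c) : Btw (a : P) b c :=
  (L.btw_iff a b c).2 (Or.inl ⟨h, h'⟩)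

theorem btw_of_gt {a b c : L.carrier} (h : c < b) (h' : b < a) : Btw (a : P) b c :=
  (L.btw_iff a b c).2 (Or.inr ⟨h, h'⟩)

theorem coe_ne {a b : L.carrier} (h : a ≠ b) : (a : P) ≠ b := fun e => h (Subtype.ext e)

theorem exists_gt_and_lt (a : L.carrier) : (∃ b, a < b) ∧ ∃ b, b < a := by
  obtain ⟨B, hB, h⟩ := exists_ne_mem L.isLine (a : P)
  obtain ⟨C, hC⟩ := btw_extend B a h
  have hCl := mem_of_btw_right L.isLine hC hB a.2
  rcases (L.btw_iff ⟨B, hB⟩ a ⟨C, hCl⟩).1 hC with h | h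
  · exact ⟨⟨_, h.2⟩, ⟨_, h.1⟩⟩
  · exact ⟨⟨_, h.2⟩, ⟨_, h.1⟩⟩

theorem exists_gt_len (a : L.carrier) {A B : P} (h : A ≠ B) :
    ∃ b, a < b ∧ len (a : P) b = len A B := by
  obtain ⟨x, hx⟩ := (exists_gt_and_lt a).2
  obtain ⟨Y, hY, hY'⟩ := exists_btw_len (coe_ne hx.ne) h
  refine ⟨⟨Y, mem_of_btw_right L.isLine hY x.2 a.2⟩, ?_, hY'⟩
  rcases (L.btw_iff x a ⟨Y, mem_of_btw_right L.isLine hY x.2 a.2⟩).1 hY with h | h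
  · exact h.2
  · exact absurd h.2 hx.not_gt

theorem exists_lt_len (a : L.carrier) {A B : P} (h : A ≠ B) :
    ∃ b, b < a ∧ len (a : P) b = len A B := by
  obtain ⟨x, hx⟩ := (exists_gt_and_lt a).1
  obtain ⟨Y, hY, hY'⟩ := exists_btw_len (coe_ne hx.ne') h
  refine ⟨⟨Y, mem_of_btw_right L.isLine hY x.2 a.2⟩, ?_, hY'⟩
  rcases (L.btw_iff x a ⟨Y, mem_of_btw_right L.isLine hY x.2 a.2⟩).1 hY with h | h
  · exact absurd h.1 hx.not_gt
  · exact h.1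

theorem eq_of_gt_of_len {a b c : L.carrier} (hb : a < b) (hc : a < c)
    (h : len (a : P) b = len (a : P) c) : b = c := by
  rcases eq_or_btw_of_len L.isLine a.2 b.2 c.2 h with h | h
  · exact Subtype.ext h
  · rcases (L.btw_iff b a c).1 h with h | h
    · exact absurd h.1 hb.not_gt
    · exact absurd h.1 hc.not_gt

theorem eq_of_lt_of_len {a b c : L.carrier} (hb : b < a) (hc : c < a)
    (h : len (a : P) b = len (a : P) c) : b = c := by
  rcases eq_or_btw_of_len L.isLine a.2 b.2 c.2 h with h | h
  · exact Subtype.ext h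
  · rcases (L.btw_iff b a c).1 h with h | h
    · exact absurd h.2 hc.not_gt
    · exact absurd h.2 hb.not_gt

/-- A segment is not congruent to a segment properly containing it. -/
theorem not_len_nested {a b c d : L.carrier} (hab : a ≤ b) (hbc : b < c) (hcd : c ≤ d)
    (h : len (b : P) c = len (a : P) d) : a = b ∧ c = d := by
  rcases hab.eq_or_lt with rfl | hab
  · exact ⟨rfl, eq_of_gt_of_len hbc (hbc.trans_le hcd) h⟩
  · exfalso
    -- Prolonging `ad` beyond `d` by a copy of `ab` makes `av` congruent to `ac`, although `c`
    -- precedes `v`.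
    obtain ⟨v, hv, hv'⟩ := exists_gt_len d (coe_ne hab.ne)
    have had := (hab.trans hbc).trans_le hcd
    have : len (a : P) c = len (v : P) a :=
      len_add (btw_of_lt hab hbc) (btw_of_gt had hv) (by rw [← hv', len_comm])
        (by rw [h, len_comm])
    rw [len_comm (v : P)] at this
    exact ((hcd.trans_lt hv).ne (eq_of_gt_of_len (hab.trans hbc) (had.trans hv) this))

/-- The point `y` lies relative to `o'` as `x` lies relative to `o`. -/
def Corr (o : L.carrier) (o' : L'.carrier) (x : L.carrier) (y : L'.carrier) : Prop :=
  len (o : P) x = len (o' : P) y ∧ (o < x ↔ o' < y) ∧ (x < o ↔ y < o')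

theorem Corr.symm {o : L.carrier} {o' : L'.carrier} {x : L.carrier} {y : L'.carrier}
    (h : Corr o o' x y) : Corr o' o y x := ⟨h.1.symm, h.2.1.symm, h.2.2.symm⟩

theorem exists_corr (o : L.carrier) (o' : L'.carrier) (x : L.carrier) :
    ∃ y, Corr o o' x y := by
  rcases lt_trichotomy o x with h | rfl | h
  · obtain ⟨y, hy, hy'⟩ := exists_gt_len o' (coe_ne h.ne)
    exact ⟨y, hy'.symm, iff_of_true h hy, iff_of_false h.not_gt hy.not_gt⟩
  · exact ⟨o', len_self _ _, by simp, by simp⟩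
  · obtain ⟨y, hy, hy'⟩ := exists_lt_len o' (coe_ne h.ne')
    exact ⟨y, hy'.symm, iff_of_false h.not_gt hy.not_gt, iff_of_true h hy⟩

theorem Corr.unique {o : L.carrier} {o' : L'.carrier} {x : L.carrier} {y z : L'.carrier}
    (h : Corr o o' x y) (h' : Corr o o' x z) : y = z := by
  obtain ⟨h1, h2, h3⟩ := h
  obtain ⟨h4, h5, h6⟩ := h'
  rcases lt_trichotomy o x with h | rfl | h
  · exact eq_of_gt_of_len (h2.1 h) (h5.1 h) (h1.symm.trans h4)
  · exact Subtype.ext ((eq_of_len_self h1).symm.trans (eq_of_len_self h4))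
  · exact eq_of_lt_of_len (h3.1 h) (h6.1 h) (h1.symm.trans h4)

/-- Only addition of segments is an axiom. When `x` and `x'` are on the same side of `o`, a copy of
`xx'` is laid off from the image nearer to `o'`; adding lengths shows that its end corresponds to
the farther point, so uniqueness identifies it. When `o` separates them, the lengths add directly.
-/
theorem Corr.lt_and_len {o : L.carrier} {o' : L'.carrier} {x x' : L.carrier} {y y' : L'.carrier}
    (h : Corr o o' x y) (h' : Corr o o' x' y') (hx : x < x') :
    y < y' ∧ len (x : P) x' = len (y : P) y' := by
  by_cases hox : o ≤ x
  · obtain ⟨w, hw, hw'⟩ := exists_gt_len y (coe_ne hx.ne)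
    have hoy : o' ≤ y := not_lt.1 fun k => hox.not_gt (h.2.2.2 k)
    have : Corr o o' x' w := by
      refine ⟨?_, iff_of_true (hox.trans_lt hx) (hoy.trans_lt hw),
        iff_of_false (hox.trans_lt hx).not_gt (hoy.trans_lt hw).not_gt⟩
      rcases hox.eq_or_lt with rfl | hox
      · rw [← hw', eq_of_len_self h.1]
      · exact len_add (btw_of_lt hox hx) (btw_of_lt (h.2.1.1 hox) hw) h.1 hw'.symm
    cases this.unique h'
    exact ⟨hw, hw'.symm⟩
  · push Not at hox
    by_cases hox' : x' ≤ o
    · obtain ⟨w, hw, hw'⟩ := exists_lt_len y' (coe_ne hx.ne')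
      have hoy : y' ≤ o' := not_lt.1 fun k => hox'.not_gt (h'.2.1.2 k)
      have : Corr o o' x w := by
        refine ⟨?_, iff_of_false hox.not_gt (hw.trans_le hoy).not_gt,
          iff_of_true hox (hw.trans_le hoy)⟩
        rcases hox'.eq_or_lt with rfl | hox'
        · rw [← hw', eq_of_len_self h'.1]
        · exact len_add (btw_of_gt hx hox') (btw_of_gt hw (h'.2.2.1 hox')) h'.1 hw'.symm
      cases this.unique h
      exact ⟨hw, by rw [len_comm, ← hw', len_comm]⟩
    · push Not at hox'
      have h1 := h.2.2.1 hox
      have h2 := h'.2.1.1 hox'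
      exact ⟨h1.trans h2, len_add (btw_of_lt hox hox') (btw_of_lt h1 h2)
        (by rw [len_comm, h.1, len_comm]) h'.1⟩

/-- Ordered lines are isometric, with any prescribed pair of corresponding points. -/
theorem exists_isometry (o : L.carrier) (o' : L'.carrier) : ∃ φ : L.carrier ≃o L'.carrier,
    φ o = o' ∧ ∀ a b : L.carrier, len (a : P) b = len (φ a : P) (φ b) := by
  choose f hf using fun x => exists_corr o o' x
  choose g hg using fun y => exists_corr o' o y
  have hmono : StrictMono f := fun x y h => ((hf x).lt_and_len (hf y) h).1
  let e : L.carrier ≃ L'.carrier :=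
    ⟨f, g, fun x => (hg (f x)).unique (hf x).symm, fun y => (hf (g y)).unique (hg y).symm⟩
  refine ⟨⟨e, fun {a b} => hmono.le_iff_le⟩, ?_, fun (a b : L.carrier) => ?_⟩
  · exact (hf o).unique ⟨len_self _ _, by simp, by simp⟩
  · change len (a : P) (b : P) = len (f a : P) (f b)
    rcases lt_trichotomy a b with h | rfl | h
    · exact ((hf a).lt_and_len (hf b) h).2
    · exact len_self _ _
    · rw [len_comm, ((hf b).lt_and_len (hf a) h).2, len_comm]

theorem isometry_unique {φ ψ : L.carrier ≃o L'.carrier}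
    (hφ : ∀ a b : L.carrier, len (a : P) b = len (φ a : P) (φ b))
    (hψ : ∀ a b : L.carrier, len (a : P) b = len (ψ a : P) (ψ b)) {o : L.carrier} (h : φ o = ψ o)
    (x : L.carrier) : φ x = ψ x := by
  have h1 : Corr o (φ o) x (φ x) := ⟨hφ o x, φ.lt_iff_lt.symm, φ.lt_iff_lt.symm⟩
  have h2 : Corr o (ψ o) x (ψ x) := ⟨hψ o x, ψ.lt_iff_lt.symm, ψ.lt_iff_lt.symm⟩
  rw [← h] at h2
  exact h1.unique h2

end OrderedLine

/-- Two points of a line equidistant from two distinct points of it coincide. -/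
theorem eq_of_equidistant {l : Set P} (hl : l ∈ lines) {A B X Y : P} (hA : A ∈ l) (hB : B ∈ l)
    (hX : X ∈ l) (hY : Y ∈ l) (hAB : A ≠ B) (h : len X A = len X B) (h' : len Y A = len Y B) :
    X = Y := by
  have hX' := (eq_or_btw_of_len hl hX hA hB h).resolve_left hAB
  have hY' := (eq_or_btw_of_len hl hY hA hB h').resolve_left hAB
  obtain ⟨L, a, b, rfl, rfl, rfl, hab⟩ := exists_orderedLine hl hA hB hAB
  lift X to L.carrier using hX
  lift Y to L.carrier using hY
  have key : ∀ X Y : L.carrier, Btw (a : P) X b → Btw (a : P) Y b → len (X : P) a = len (X : P) b →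
      len (Y : P) a = len (Y : P) b → ¬ X < Y := by
    intro X Y hX hY h h' hXY
    have h1 : a < X ∧ X < b := ((L.btw_iff _ _ _).1 hX).resolve_right
      fun k => hab.not_gt (k.1.trans k.2)
    have h2 : a < Y ∧ Y < b := ((L.btw_iff _ _ _).1 hY).resolve_right
      fun k => hab.not_gt (k.1.trans k.2)
    -- With `Yw` congruent to `YX`, `aw` is the sum of `aY` and `YX`, hence congruent to `bX` and so
    -- to `aX`, although `X < w`.
    obtain ⟨w, hw, hw'⟩ := OrderedLine.exists_gt_len Y (OrderedLine.coe_ne hXY.ne')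
    have h3 : len (a : P) w = len (b : P) X :=
      len_add (OrderedLine.btw_of_lt h2.1 hw) (OrderedLine.btw_of_gt hXY h2.2)
        (by rw [len_comm, h', len_comm]) hw'
    rw [len_comm (b : P), ← h, len_comm (X : P)] at h3
    exact (hXY.trans hw).ne' (OrderedLine.eq_of_gt_of_len (h2.1.trans hw) h1.1 h3)
  congr 1
  exact le_antisymm (not_lt.1 (key Y X hY' hX' h' h)) (not_lt.1 (key X Y hX' hY' h h'))

theorem exists_midpoint_mem {l : Set P} (hl : l ∈ lines) {A B : P} (h : A ≠ B) (hA : A ∈ l)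
    (hB : B ∈ l) : ∃ M ∈ l, M ≠ A ∧ M ≠ B ∧ Btw A M B ∧ len M A = len M B := by
  obtain ⟨M, hM⟩ := exists_midpoint A B h
  obtain ⟨h1, h2⟩ := isMidpoint_iff.1 hM
  have h3 := btw_distinct _ _ _ h1
  exact ⟨M, mem_of_btw_mid hl h1 hA hB, h3.1.symm, h3.2.1, h1, h2⟩

theorem exists_reflection {l : Set P} (hl : l ∈ lines) {M B : P} (h : B ≠ M) (hM : M ∈ l)
    (hB : B ∈ l) : ∃ C ∈ l, C ≠ M ∧ C ≠ B ∧ Btw B M C ∧ len M B = len M C := by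
  obtain ⟨C, h1, h2⟩ := exists_btw_len h h.symm
  have h3 := btw_distinct _ _ _ h1
  exact ⟨C, mem_of_btw_right hl h1 hB hM, h3.2.1.symm, h3.2.2.symm, h1, h2.symm⟩

/-! ### Right angles -/

theorem _root_.PlaneGeometry.IsRightAngle.symm {A M B : P} (h : IsRightAngle A M B) : IsRightAngle B M A :=
  Or.symm h

theorem mem_ray_trans {l : Set P} (hl : l ∈ lines) {M A A' X : P} (hM : M ∈ l) (hA : A ∈ l)
    (hA' : A' ∈ l) (hAM : A ≠ M) (hA'M : A' ≠ M) (h : ¬ Btw A M A') (hX : X ∈ ray M A) :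
    X ∈ ray M A' := by
  have hXl : X ∈ l := by
    rcases hX with rfl | rfl | h | h
    · exact hM
    · exact hA
    · exact mem_of_btw_mid hl h hM hA
    · exact mem_of_btw_right hl h hM hA
  refine mem_ray_of hl hM hA' hXl hA'M fun k => ?_
  have hXM := (btw_distinct _ _ _ k).2.1.symm
  obtain ⟨f, hf⟩ := exists_ray_side hl hM
  have h1 := hf A hA hAM A' hA' hA'M
  have h2 := hf A hA hAM X hXl hXM
  have h3 := hf A' hA' hA'M X hXl hXM
  have h4 : ¬ Btw A M X := by
    intro k
    rcases hX with rfl | rfl | h | h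
    · exact hXM rfl
    · exact (btw_distinct _ _ _ k).2.2 rfl
    · exact btw_unique _ _ _ k h
    · exact btw_unique _ _ _ (btw_symm _ _ _ k) h
  tauto

theorem _root_.PlaneGeometry.IsRightAngle.ray_left {l : Set P} (hl : l ∈ lines) {M A A' B : P} (hM : M ∈ l)
    (hA : A ∈ l) (hA' : A' ∈ l) (hAM : A ≠ M) (hA'M : A' ≠ M) (h : ¬ Btw A M A')
    (hr : IsRightAngle A M B) : IsRightAngle A' M B := by
  rcases hr with ⟨X, hX, Y, hY, Z, hZ⟩ | ⟨X, hX, Y, hY, Z, hZ⟩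
  · exact Or.inl ⟨X, mem_ray_trans hl hM hA hA' hAM hA'M h hX, Y, hY, Z, hZ⟩
  · exact Or.inr ⟨X, hX, Y, mem_ray_trans hl hM hA hA' hAM hA'M h hY, Z, hZ⟩

theorem len_hyp_of_right {A M B A' M' B' : P} (h : IsRightAngle A M B)
    (h' : IsRightAngle A' M' B') (h₁ : len M A = len M' A') (h₂ : len M B = len M' B') :
    len A B = len A' B' :=
  cong_iff.1 (right_angles_equal M A B M' A' B' h h' (cong_iff.2 h₁) (cong_iff.2 h₂))

/-- `A` is off the line `MB`, and `A` is equidistant from `B` and from its reflection in `M`. -/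
def Orth (A M B : P) : Prop :=
  ∃ l ∈ lines (P := P), M ∈ l ∧ B ∈ l ∧ A ∉ l ∧ ∃ C, Btw B M C ∧ len M B = len M C ∧
    len A B = len A C

theorem orth_of_equidistant {l : Set P} (hl : l ∈ lines) {A M B C : P} (hB : B ∈ l)
    (hC : C ∈ l) (hA : A ∉ l) (hM : Btw B M C) (h : len M B = len M C) (h' : len A B = len A C) :
    Orth A M B :=
  ⟨l, hl, mem_of_btw_mid hl hM hB hC, hB, hA, C, hM, h, h'⟩

theorem Orth.ne {A M B : P} (h : Orth A M B) : B ≠ M := by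
  obtain ⟨l, -, -, -, -, C, h, -⟩ := h
  exact (btw_distinct _ _ _ h).1

theorem Orth.not_mem {A M B : P} (h : Orth A M B) {l : Set P} (hl : l ∈ lines) (hM : M ∈ l)
    (hB : B ∈ l) : A ∉ l := by
  have hne := h.ne
  obtain ⟨m, hm, hMm, hBm, hA, -⟩ := h
  exact line_eq hl hm hne hB hM hBm hMm ▸ hA

theorem Orth.ne_left {A M B : P} (h : Orth A M B) : A ≠ M := by
  obtain ⟨m, hm, hMm, hBm, hA, -⟩ := h
  rintro rfl; exact hA hMm

theorem Orth.isRightAngle {A M B : P} (h : Orth A M B) : IsRightAngle A M B := by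
  obtain ⟨l, hl, hM, hB, hA, C, h1, h2, h3⟩ := h
  refine Or.inl ⟨A, Or.inr (Or.inl rfl), B, Or.inr (Or.inl rfl), C, ?_,
    isMidpoint_iff.2 ⟨h1, h2⟩, cong_iff.2 h3⟩
  rintro ⟨m, hm, hAm, hBm, hCm⟩
  exact hA (line_eq hl hm (btw_distinct _ _ _ h1).2.2 hB (mem_of_btw_right hl h1 hB hM)
    hBm hCm ▸ hAm)

/-- The right angle `AMB` gives right angles with all the points of the line `MB`. -/
theorem Orth.right {l : Set P} (hl : l ∈ lines) {A M B B' : P} (hM : M ∈ l) (hB : B ∈ l)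
    (hB' : B' ∈ l) (hne : B' ≠ M) (h : Orth A M B) : Orth A M B' := by
  have key : ∀ X ∈ l, X ≠ M → IsRightAngle A M X := by
    intro X hX hXM
    by_cases k : Btw B M X
    · have hA := h.not_mem hl hM hB
      have hBM := h.ne
      obtain ⟨m, hm, hMm, hBm, hAm, C, h1, h2, h3⟩ := h
      have hC := mem_of_btw_right hl h1 hB hM
      have h4 := btw_distinct _ _ _ h1
      have : Orth A M C := orth_of_equidistant hl hC hB hA (btw_symm _ _ _ h1) h2.symm h3.symm
      refine IsRightAngle.symm (IsRightAngle.ray_left hl hM hC hX h4.2.1.symm hXM ?_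
        (IsRightAngle.symm this.isRightAngle))
      obtain ⟨f, hf⟩ := exists_ray_side hl hM
      have h1' := hf B hB hBM C hC h4.2.1.symm
      have h2' := hf B hB hBM X hX hXM
      have h3' := hf C hC h4.2.1.symm X hX hXM
      tauto
    · exact IsRightAngle.symm (IsRightAngle.ray_left hl hM hB hX h.ne hXM k
        (IsRightAngle.symm h.isRightAngle))
  -- `B'` and its reflection `C` both make right angles with `A` at `M`, with congruent legs, so the
  -- hypotenuses agree.
  obtain ⟨C, hC, hCM, -, h1, h2⟩ := exists_reflection hl hne hM hB'
  exact orth_of_equidistant hl hB' hC (h.not_mem hl hM hB) h1 h2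
    (len_hyp_of_right (key B' hB' hne) (key C hC hCM) rfl h2)

/-- A triangle does not have two right angles. -/
theorem not_right_right {l : Set P} (hl : l ∈ lines) {A M N : P} (hM : M ∈ l) (hN : N ∈ l)
    (hMN : M ≠ N) (hA : A ∉ l) (h : IsRightAngle A M N) (h' : IsRightAngle A N M) : False := by
  refine right_angle_unique M N A (not_collinear hl hMN hM hN hA) ⟨IsRightAngle.symm h, ?_⟩
  exact IsRightAngle.symm h'

/-- In a right triangle, the hypotenuse and a leg determine the other leg. -/
theorem len_leg_of_right {l : Set P} (hl : l ∈ lines) {A N B A' N' B' : P} (hN : N ∈ l)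
    (hB : B ∈ l) (hA : A ∉ l) (hBN : B ≠ N) (hBN' : B' ≠ N') (h : IsRightAngle A N B)
    (h' : IsRightAngle A' N' B') (h₁ : len N A = len N' A') (h₂ : len A B = len A' B') :
    len N B = len N' B' := by
  -- `C` copies `B'` onto the ray of `B`. If it missed `B`, the midpoint `K` of `BC` would be a
  -- second foot of the perpendicular from `A`.
  obtain ⟨C, hC, hCN, hCB, hC'⟩ := exists_same_ray_len hl hN hB hBN hBN'.symm
  have hr : IsRightAngle A N C := IsRightAngle.symm
    (IsRightAngle.ray_left hl hN hB hC hBN hCN hCB (IsRightAngle.symm h))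
  have h3 : len A C = len A B := (len_hyp_of_right hr h' h₁ hC').trans h₂.symm
  by_cases hBC : B = C
  · rw [hBC, hC']
  exfalso
  obtain ⟨K, hK, hKB, hKC, h4, h5⟩ := exists_midpoint_mem hl hBC hB hC
  have ho : Orth A K B := orth_of_equidistant hl hB hC hA h4 h5 h3.symm
  have hKN : K ≠ N := by rintro rfl; exact hCB h4
  refine not_right_right hl hK hN hKN hA (ho.right hl hK hB hN hKN.symm).isRightAngle ?_
  refine IsRightAngle.symm (IsRightAngle.ray_left hl hN hB hK hBN hKN ?_ (IsRightAngle.symm h))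
  intro k
  obtain ⟨L, b, k', rfl, rfl, rfl, hlt⟩ := exists_orderedLine hl hB hK hKB.symm
  lift N to L.carrier using hN
  lift C to L.carrier using hC
  rw [L.btw_iff] at h4 hCB k
  have h6 := h4.resolve_right fun q => hlt.not_gt q.2
  have h7 := k.resolve_right fun q => hlt.not_gt (q.1.trans q.2)
  exact hCB (Or.inl ⟨h7.1, h7.2.trans h6.2⟩)

/-- The diagonals of a quadrilateral with four equal sides bisect each other if their
lines meet. -/
theorem btw_midpoint_of_rhombus {l m : Set P} (hl : l ∈ lines) (hm : m ∈ lines)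
    {A A' B C N X : P} (hA : A ∈ l) (hA' : A' ∈ l) (hB : B ∈ m) (hC : C ∈ m) (hBC : B ≠ C)
    (hBl : B ∉ l) (hCl : C ∉ l) (hXl : X ∈ l) (hXm : X ∈ m) (hN : Btw A N A')
    (hN' : len N A = len N A') (h₁ : len A B = len A C) (h₂ : len A' B = len A B)
    (h₃ : len A' C = len A B) : Btw B N C ∧ len N B = len N C := by
  have hNl := mem_of_btw_mid hl hN hA hA'
  have hAN := (btw_distinct _ _ _ hN).1
  have hA'N := (btw_distinct _ _ _ hN).2.1.symm
  have hAA' := (btw_distinct _ _ _ hN).2.2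
  obtain ⟨M, hM, hMB, hMC, hM', hM''⟩ := exists_midpoint_mem hm hBC hB hC
  have oB : Orth B N A := orth_of_equidistant hl hA hA' hBl hN hN' (by
    rw [len_comm, ← h₂, len_comm])
  have oC : Orth C N A := orth_of_equidistant hl hA hA' hCl hN hN' (by
    rw [len_comm, ← h₁, ← h₃, len_comm])
  have hlm : ∀ Y, Y ∈ l → Y ∈ m → Y = X := by
    intro Y hY hYm
    by_contra k
    exact hBl (line_eq hl hm k hY hXl hYm hXm ▸ hB)
  -- If `A` were on `m` it would be the midpoint `M`, and the triangle `ANB` would have right angles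
  -- at both `A` and `N`.
  have offm : ∀ A A' : P, A ∈ l → A' ∈ l → A ≠ A' → A ≠ N → ¬ Btw A' A N → len A B = len A C →
      len A' B = len A' C → Orth B N A → A ∉ m := by
    intro A A' hA hA' hAA' hAN hray h h' oB hAm
    have hA'm : A' ∉ m := fun k => hAA' ((hlm A hA hAm).trans (hlm A' hA' k).symm)
    have hAM : A = M := eq_of_equidistant hm hB hC hAm hM hBC h hM''
    subst hAM
    have o2 : Orth A' A B := orth_of_equidistant hm hB hC hA'm hM' hM'' h'
    refine not_right_right hl hNl hA hAN.symm hBl oB.isRightAngle ?_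
    exact IsRightAngle.symm (IsRightAngle.ray_left hl hA hA' hNl hAA'.symm hAN.symm hray
      o2.isRightAngle)
  have hAm : A ∉ m := offm A A' hA hA' hAA' hAN
    (fun k => btw_unique _ _ _ k hN) h₁ (h₂.trans h₃.symm) oB
  have hA'm : A' ∉ m := offm A' A hA' hA hAA'.symm hA'N
    (fun k => btw_unique _ _ _ k (btw_symm _ _ _ hN)) (h₂.trans h₃.symm) h₁
    (oB.right hl hNl hA hA' hA'N)
  -- the midpoint of `BC` is equidistant from `A` and `A'`
  have oA : Orth A M B := orth_of_equidistant hm hB hC hAm hM' hM'' h₁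
  have oA' : Orth A' M B := orth_of_equidistant hm hB hC hA'm hM' hM'' (h₂.trans h₃.symm)
  have hNB : len N B = len N C := by
    obtain ⟨n, hn, hNn, hBn⟩ := exists_line (A := N) (B := B) (by rintro rfl; exact hBl hNl)
    have hAn : A ∉ n := fun k => hBl (line_eq hl hn hAN hA hNl k hNn ▸ hBn)
    refine len_leg_of_right hn hNn hBn hAn (by rintro rfl; exact hBl hNl)
      (by rintro rfl; exact hCl hNl) (IsRightAngle.symm oB.isRightAngle)
      (IsRightAngle.symm oC.isRightAngle) rfl h₁
  have hMA : len M A = len M A' := by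
    obtain ⟨n, hn, hMn, hAn⟩ := exists_line (A := M) (B := A) (by rintro rfl; exact hAm hM)
    have hBn : B ∉ n := fun k => hAm (line_eq hm hn hMB.symm hB hM k hMn ▸ hAn)
    exact len_leg_of_right hn hMn hAn hBn (by rintro rfl; exact hAm hM)
      (by rintro rfl; exact hA'm hM) (IsRightAngle.symm oA.isRightAngle)
      (IsRightAngle.symm oA'.isRightAngle) rfl (by rw [len_comm, ← h₂, len_comm])
  by_cases hNm : N ∈ m
  · have : N = M := eq_of_equidistant hm hB hC hNm hM hBC hNB hM''
    exact ⟨this ▸ hM', hNB⟩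
  -- Otherwise `MN` is perpendicular to `l` at `N` and to `m` at `M`, and the triangle `XMN` has two
  -- right angles.
  exfalso
  have hMl : M ∉ l := fun k => hNm
    (eq_of_equidistant hl hA hA' k hNl hAA' hMA hN' ▸ hM)
  have o1 : Orth M N A := orth_of_equidistant hl hA hA' hMl hN hN' hMA
  have o2 : Orth N M B := orth_of_equidistant hm hB hC hNm hM' hM'' hNB
  have hXN : X ≠ N := by rintro rfl; exact hNm hXm
  have hXM : X ≠ M := by rintro rfl; exact hMl hXl
  have o3 := o1.right hl hNl hA hXl hXN
  have o4 := o2.right hm hM hB hXm hXM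
  obtain ⟨n, hn, hMn, hNn⟩ := exists_line (A := M) (B := N) (by rintro rfl; exact hMl hNl)
  refine not_right_right hn hMn hNn (by rintro rfl; exact hMl hNl) (A := X) ?_
    (IsRightAngle.symm o4.isRightAngle) (IsRightAngle.symm o3.isRightAngle)
  intro k
  exact hMl (line_eq hl hn hXN hXl hNl k hNn ▸ hMn)

/-- Congruent triangles on the two sides of a common base. -/
theorem exists_opposite {l : Set P} (hl : l ∈ lines) {A A' B : P} (hA : A ∈ l) (hA' : A' ∈ l)
    (hAA' : A ≠ A') (hB : B ∉ l) :
    ∃ C, C ∉ l ∧ (∃ X ∈ l, Btw B X C) ∧ len A C = len A B ∧ len A' C = len A' B := by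
  obtain ⟨f, ⟨D, hD, fD⟩, ⟨E, hE, fE⟩, hf⟩ := exists_side hl
  obtain ⟨G, hG, hGB⟩ : ∃ G, G ∉ l ∧ ¬ (f G ↔ f B) := by
    by_cases h : f B
    · exact ⟨E, hE, by tauto⟩
    · exact ⟨D, hD, by tauto⟩
  obtain ⟨C, ⟨h1, -, h2⟩, h3, h4⟩ := triangle_transport A A' B A A'
    (not_collinear hl hAA' hA hA' hB) (cong_refl _ _) l hl hA hA' G hG
  refine ⟨C, h1, ?_, cong_iff.1 h3, cong_iff.1 h4⟩
  have h5 := hf C h1 G hG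
  have h6 : ¬ ∃ X ∈ l, Btw C X G := fun ⟨X, hX, hX'⟩ => h2 X hX hX'
  exact (hf B hB C h1).2 (by tauto)

/-- The mirror image `C` of `B` in `l` comes from transporting the triangle on `AA'` to the other
side; the rhombus lemma then forces `BC` through `N`. -/
theorem Orth.exists_rhombus {l : Set P} (hl : l ∈ lines) {A N B : P} (hN : N ∈ l) (hA : A ∈ l)
    (h : Orth B N A) : ∃ A' C, A' ∈ l ∧ C ∉ l ∧ Btw A N A' ∧ len N A = len N A' ∧
      Btw B N C ∧ len N B = len N C ∧ len B A = len B A' ∧ len C A = len B A ∧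
      len C A' = len B A := by
  have hB := h.not_mem hl hN hA
  obtain ⟨-, -, -, -, -, A', h1, h2, h3⟩ := h
  have hA' := mem_of_btw_right hl h1 hA hN
  obtain ⟨C, hC, ⟨X, hX, hX'⟩, h4, h5⟩ :=
    exists_opposite hl hA hA' (btw_distinct _ _ _ h1).2.2 hB
  have hBC := (btw_distinct _ _ _ hX').2.2
  obtain ⟨m, hm, hBm, hCm⟩ := exists_line hBC
  have h6 : len C A = len B A := by rw [len_comm, h4, len_comm]
  have h7 : len C A' = len B A := by rw [len_comm, h5, len_comm, h3]
  obtain ⟨h8, h9⟩ := btw_midpoint_of_rhombus hl hm hA hA' hBm hCm hBC hB hC hX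
    (mem_of_btw_mid hm hX' hBm hCm) h1 h2 h4.symm (by rw [len_comm, ← h3, len_comm])
    (by rw [len_comm, h7, len_comm])
  exact ⟨A', C, hA', hC, h1, h2, h8, h9, h3, h6, h7⟩

/-- The rhombus treats its two diagonals alike, whereas the definition of `Orth` does not treat its
two legs alike. -/
theorem Orth.symm {A M B : P} (h : Orth A M B) : Orth B M A := by
  obtain ⟨l, hl, hMl, hBl⟩ := exists_line h.ne.symm
  have hA := h.not_mem hl hMl hBl
  have hBM := h.ne
  obtain ⟨m, hm, hMm, hAm⟩ := exists_line h.ne_left.symm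
  obtain ⟨B', C, hB', hC, -, -, h1, h2, h3, h4, -⟩ := h.exists_rhombus hl hMl hBl
  exact orth_of_equidistant hm hAm (mem_of_btw_right hm h1 hAm hMm)
    (fun k => hA (line_eq hl hm hBM hBl hMl k hMm ▸ hAm)) h1 h2
    (by rw [len_comm, ← h4, len_comm])

/-- There is at most one perpendicular to a line at a given point of it. -/
theorem orth_unique {l : Set P} (hl : l ∈ lines) {A N B D : P} (hN : N ∈ l) (hA : A ∈ l)
    (h : Orth B N A) (h' : Orth D N A) {m : Set P} (hm : m ∈ lines) (hNm : N ∈ m) (hBm : B ∈ m) :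
    D ∈ m := by
  have hB := h.not_mem hl hN hA
  have hD := h'.not_mem hl hN hA
  obtain ⟨A', C, hA', hC, h1, h2, h3, h4, h5, h6, h7⟩ := h.exists_rhombus hl hN hA
  have hCm := mem_of_btw_right hm h3 hBm hNm
  have hAA' := (btw_distinct _ _ _ h1).2.2
  have hA'N := (btw_distinct _ _ _ h1).2.1.symm
  -- a point of `m` on the other side of `l`
  have key : ∀ E ∈ m, E ∉ l → len E A = len E A' → (∃ X ∈ l, Btw D X E) → D ∈ m := by
    intro E hE hEl hEA ⟨X, hX, hX'⟩
    have hEN : E ≠ N := by rintro rfl; exact hEl hN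
    have hDN := h'.ne_left
    have oE : Orth E N A := orth_of_equidistant hl hA hA' hEl h1 h2 hEA
    obtain ⟨k, hk, hNk, hDk⟩ := exists_line hDN.symm
    -- Rescaling `D` to the distance of `E` from `N` makes `A`, `D'`, `A'`, `E` the vertices of a
    -- rhombus, so `D'E` passes through `N` and lies on `m`.
    obtain ⟨D', hD', hD'N, hD'D, hlen⟩ := exists_same_ray_len hk hNk hDk hDN hEN.symm
    have hkl : ∀ Y ∈ k, Y ≠ N → Y ∉ l := fun Y hY hYN hYl =>
      hD (line_eq hl hk hYN hYl hN hY hNk ▸ hDk)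
    have hD'l := hkl D' hD' hD'N
    have rA : IsRightAngle D' N A :=
      IsRightAngle.ray_left hk hNk hDk hD' hDN hD'N hD'D h'.isRightAngle
    have rA' : IsRightAngle D' N A' :=
      IsRightAngle.ray_left hk hNk hDk hD' hDN hD'N hD'D
        (h'.right hl hN hA hA' hA'N).isRightAngle
    have e1 := len_hyp_of_right rA oE.isRightAngle hlen rfl
    have e2 := len_hyp_of_right rA' oE.isRightAngle hlen h2.symm
    obtain ⟨f, -, -, hf⟩ := exists_side hl
    have s1 := (hf D hD E hEl).1 ⟨X, hX, hX'⟩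
    have s2 : ¬ ∃ X ∈ l, Btw D X D' := by
      rintro ⟨Y, hY, hY'⟩
      have := mem_of_btw_mid hk hY' hDk hD'
      by_cases hYN : Y = N
      · subst hYN; exact hD'D hY'
      · exact hkl Y this hYN hY
    rw [hf D hD D' hD'l] at s2
    obtain ⟨Z, hZ, hZ'⟩ := (hf D' hD'l E hEl).2 (by tauto)
    have hD'E := (btw_distinct _ _ _ hZ').2.2
    obtain ⟨n, hn, hD'n, hEn⟩ := exists_line hD'E
    obtain ⟨h8, h9⟩ := btw_midpoint_of_rhombus hl hn hA hA' hD'n hEn hD'E hD'l hEl hZ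
      (mem_of_btw_mid hn hZ' hD'n hEn) h1 h2 (by rw [len_comm, e1, len_comm])
      (by rw [len_comm, e2, ← e1, len_comm]) (by rw [len_comm, ← hEA, ← e1, len_comm])
    have hNn := mem_of_btw_mid hn h8 hD'n hEn
    have : m = n := line_eq hm hn hEN hE hNm hEn hNn
    subst this
    have : m = k := line_eq hm hk hD'N hD'n hNm hD' hNk
    exact this ▸ hDk
  obtain ⟨f, -, -, hf⟩ := exists_side hl
  by_cases hDB : ∃ X ∈ l, Btw D X B
  · exact key B hBm hB h5 hDB
  · refine key C hCm hC (h6.trans h7.symm) ((hf D hD C hC).2 ?_)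
    rw [hf D hD B hB] at hDB
    have s2 := (hf B hB C hC).1 ⟨N, hN, h3⟩
    tauto

/-- On a given side of a line, a point is determined by its distances from two points of the
line. -/
theorem eq_of_sameSide {l : Set P} (hl : l ∈ lines) {A B C D : P} (hA : A ∈ l) (hB : B ∈ l)
    (hAB : A ≠ B) (h : SameSide l C D) (h₁ : len A C = len A D) (h₂ : len B C = len B D) :
    C = D := by
  by_contra hCD
  obtain ⟨hC, hD, hs⟩ := h
  obtain ⟨n, hn, hCn, hDn⟩ := exists_line hCD
  obtain ⟨M, hM, hMC, hMD, h3, h4⟩ := exists_midpoint_mem hn hCD hCn hDn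
  have hMl : M ∉ l := fun k => hs M k h3
  -- `A` and `B` lie on the one perpendicular to `CD` at its midpoint `M`, so `l` would pass through
  -- `M` and separate `C` from `D`.
  have off : ∀ X ∈ l, len X C = len X D → Orth X M C := by
    intro X hX hXC
    refine orth_of_equidistant hn hCn hDn (fun k => ?_) h3 h4 hXC
    exact hMl (eq_of_equidistant hn hCn hDn k hM hCD hXC h4 ▸ hX)
  have oA := off A hA h₁
  have oB := off B hB h₂
  obtain ⟨k, hk, hMk, hAk⟩ := exists_line oA.ne_left.symm
  have hBk := orth_unique hn hM hCn oA oB hk hMk hAk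
  exact hMl (line_eq hl hk hAB hA hB hAk hBk ▸ hMk)

/-! ### Perpendiculars -/

theorem Orth.perp {l n : Set P} (hl : l ∈ lines) (hn : n ∈ lines) {A M B : P} (hM : M ∈ l)
    (hB : B ∈ l) (hMn : M ∈ n) (hA : A ∈ n) (h : Orth A M B) : Perp l n := by
  have hBM := h.ne
  obtain ⟨B', C, hB', hC, h1, h2, h3, h4, h5, h6, h7⟩ := h.exists_rhombus hl hM hB
  have hCn := mem_of_btw_right hn h3 hA hMn
  refine ⟨hl, hn, M, B, A, C, B', hB, hB', hA, hCn, ?_, isMidpoint_iff.2 ⟨h1, h2⟩,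
    isMidpoint_iff.2 ⟨h3, h4⟩, ?_, ?_, ?_⟩
  · have hAM := h.ne_left
    rintro ⟨k, hk, hBk, hAk, hCk⟩
    have hnk := line_eq hn hk (btw_distinct _ _ _ h3).2.2 hA hCn hAk hCk
    exact h.not_mem hl hM hB (line_eq hn hl hBM (hnk ▸ hBk) hMn hB hM ▸ hA)
  · rw [cong_iff, len_comm B A, len_comm B C, h6]
  · rw [cong_iff, len_comm B A, len_comm B' A, h5]
  · rw [cong_iff, len_comm B A, len_comm B' C, h7]

theorem _root_.PlaneGeometry.Perp.exists_orth {l n : Set P} (h : Perp l n) : ∃ M, M ∈ l ∧ M ∈ n ∧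
    ∀ B ∈ l, B ≠ M → ∀ A ∈ n, A ≠ M → Orth A M B := by
  obtain ⟨hl, hn, M, A, B, C, D, hA, hD, hB, hC, hcol, h1, h2, h3, h4, h5⟩ := h
  rw [isMidpoint_iff] at h1 h2
  rw [cong_iff] at h3 h4 h5
  have hMl := mem_of_btw_mid hl h1.1 hA hD
  have hMn := mem_of_btw_mid hn h2.1 hB hC
  have hAM := (btw_distinct _ _ _ h1.1).1
  have hAn : A ∉ n := fun k => hcol ⟨n, hn, k, hB, hC⟩
  have o : Orth A M B := orth_of_equidistant hn hB hC hAn h2.1 h2.2 h3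
  refine ⟨M, hMl, hMn, fun X hX hXM Y hY hYM => ?_⟩
  have o1 := (o.right hn hMn hB hY hYM).symm
  exact o1.right hl hMl hA hX hXM

theorem _root_.PlaneGeometry.Perp.symm {l n : Set P} (h : Perp l n) : Perp n l := by
  obtain ⟨M, hMl, hMn, ho⟩ := h.exists_orth
  obtain ⟨B, hB, hBM⟩ := exists_ne_mem h.1 M
  obtain ⟨A, hA, hAM⟩ := exists_ne_mem h.2.1 M
  exact (ho B hB hBM A hA hAM).symm.perp h.2.1 h.1 hMn hA hMl hB

theorem _root_.PlaneGeometry.Perp.eq_of_mem {l n : Set P} (h : Perp l n) {X Y : P} (hXl : X ∈ l) (hXn : X ∈ n)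
    (hYl : Y ∈ l) (hYn : Y ∈ n) : X = Y := by
  obtain ⟨M, hMl, hMn, ho⟩ := h.exists_orth
  have key : ∀ X ∈ l, X ∈ n → X = M := by
    intro X hXl hXn
    by_contra hXM
    exact (ho X hXl hXM X hXn hXM).not_mem h.1 hMl hXl hXl
  rw [key X hXl hXn, key Y hYl hYn]

theorem _root_.PlaneGeometry.Perp.orth {l n : Set P} (h : Perp l n) {M A B : P} (hMl : M ∈ l) (hMn : M ∈ n)
    (hB : B ∈ l) (hBM : B ≠ M) (hA : A ∈ n) (hAM : A ≠ M) : Orth A M B := by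
  obtain ⟨N, hNl, hNn, ho⟩ := h.exists_orth
  cases h.eq_of_mem hNl hNn hMl hMn
  exact ho B hB hBM A hA hAM

theorem exists_orth_of_not_mem {l : Set P} (hl : l ∈ lines) {A : P} (hA : A ∉ l) :
    ∃ N ∈ l, ∀ B ∈ l, B ≠ N → Orth A N B := by
  obtain ⟨B, hB, C, hC, hBC⟩ := two_points l hl
  obtain ⟨A', hA', ⟨X, hX, hX'⟩, h1, h2⟩ := exists_opposite hl hB hC hBC hA
  have hAA' := (btw_distinct _ _ _ hX').2.2
  obtain ⟨n, hn, hAn, hA'n⟩ := exists_line hAA'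
  obtain ⟨N, hN, hNA, hNA', h3, h4⟩ := exists_midpoint_mem hn hAA' hAn hA'n
  have hXn := mem_of_btw_mid hn hX' hAn hA'n
  have key : ∀ B ∈ l, len B A' = len B A → B ∈ n → B = N := fun B _ h1 hBn =>
    eq_of_equidistant hn hAn hA'n hBn hN hAA' h1.symm h4
  -- Points of `l` equidistant from `A` and its mirror image `A'` either equal `N` or lie on the
  -- perpendicular to `n` at `N`; either way `N` is on `l`.
  have hNl : N ∈ l := by
    by_cases hBn : B ∈ n
    · exact key B hB h1 hBn ▸ hB
    by_cases hCn : C ∈ n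
    · exact key C hC h2 hCn ▸ hC
    have oB : Orth B N A := orth_of_equidistant hn hAn hA'n hBn h3 h4 h1.symm
    have oC : Orth C N A := orth_of_equidistant hn hAn hA'n hCn h3 h4 h2.symm
    obtain ⟨k, hk, hNk, hBk⟩ := exists_line oB.ne_left.symm
    have hCk := orth_unique hn hN hAn oB oC hk hNk hBk
    exact line_eq hl hk hBC hB hC hBk hCk ▸ hNk
  obtain ⟨D, hD, hDN, hDlen⟩ : ∃ D ∈ l, D ≠ N ∧ len D A' = len D A := by
    by_cases hBN : B = N
    · exact ⟨C, hC, fun h => hBC (hBN.trans h.symm), h2⟩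
    · exact ⟨B, hB, hBN, h1⟩
  have oD : Orth D N A := orth_of_equidistant hn hAn hA'n
    (fun k => hDN (key D hD hDlen k)) h3 h4 hDlen.symm
  exact ⟨N, hNl, fun Y hY hYN => oD.symm.right hl hNl hD hY hYN⟩

/-- A perpendicular can be erected at a point of a line, on either side and of any length. -/
theorem exists_orth_of_mem {l : Set P} (hl : l ∈ lines) {N D U V : P} (hN : N ∈ l) (hD : D ∉ l)
    (hUV : U ≠ V) :
    ∃ A, SameSide l A D ∧ len N A = len U V ∧ ∀ B ∈ l, B ≠ N → Orth A N B := by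
  -- an isosceles triangle over a base of `l` with midpoint `M`
  obtain ⟨M, hM, ho⟩ := exists_orth_of_not_mem hl hD
  obtain ⟨G, hG, hGM⟩ := exists_ne_mem hl M
  obtain ⟨G', C, hG', -, h1, h2, -, -, h5, -, -⟩ := (ho G hG hGM).exists_rhombus hl hM hG
  obtain ⟨Q, hQ, hQN⟩ := exists_ne_mem hl N
  obtain ⟨L, n, -, rfl, rfl, -, -⟩ := exists_orderedLine hl hN hQ hQN.symm
  obtain ⟨b, hb, hb'⟩ := OrderedLine.exists_lt_len n hGM.symm
  obtain ⟨c, hc, hc'⟩ := OrderedLine.exists_gt_len n hGM.symm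
  have hbc : len (b : P) c = len G G' :=
    len_add (OrderedLine.btw_of_lt hb hc) h1 (by rw [len_comm, hb', len_comm])
      (hc'.trans h2)
  -- The isosceles triangle is moved to a base with midpoint `n`, so that its apex gives a
  -- perpendicular there.
  obtain ⟨E, hE, h6, h7⟩ := triangle_transport G G' D b c
    (not_collinear hl (btw_distinct _ _ _ h1).2.2 hG hG' hD) (cong_iff.2 hbc) L.carrier hl b.2 c.2
    D hD
  rw [cong_iff] at h6 h7
  have oE : Orth E n b := orth_of_equidistant hl b.2 c.2 hE.1 (OrderedLine.btw_of_lt hb hc)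
    (hb'.trans hc'.symm) (by rw [len_comm, h6, len_comm, h5, len_comm, ← h7, len_comm])
  obtain ⟨k, hk, hNk, hEk⟩ := exists_line oE.ne_left.symm
  obtain ⟨A, hA, hAN, hEA, hlen⟩ := exists_same_ray_len hk hNk hEk oE.ne_left hUV
  have hkl : ∀ Y ∈ k, Y ≠ (n : P) → Y ∉ L.carrier := fun Y hY hYN hYl =>
    hE.1 (line_eq hl hk hYN hYl hN hY hNk ▸ hEk)
  refine ⟨A, ⟨hkl A hA hAN, hD, ?_⟩, hlen, fun B hB hBN =>
    ((oE.symm.right hk hNk hEk hA hAN).symm.right hl hN b.2 hB hBN)⟩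
  obtain ⟨f, -, -, hf⟩ := exists_side hl
  have s1 : ¬ ∃ X ∈ L.carrier, Btw E X D := fun ⟨X, hX, hX'⟩ => hE.2.2 X hX hX'
  have s2 : ¬ ∃ X ∈ L.carrier, Btw E X A := by
    rintro ⟨X, hX, hX'⟩
    have hXk := mem_of_btw_mid hk hX' hEk hA
    by_cases hXN : X = (n : P)
    · exact hEA (hXN ▸ hX')
    · exact hkl X hXk hXN hX
  rw [hf E hE.1 D hD] at s1
  rw [hf E hE.1 A (hkl A hA hAN)] at s2
  intro X hX hX'
  have := (hf A (hkl A hA hAN) D hD).1 ⟨X, hX, hX'⟩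
  tauto

/-! ### Feet of perpendiculars -/

theorem exists_isFoot {l : Set P} (hl : l ∈ lines) (A : P) : ∃ F, IsFoot A l F := by
  by_cases hA : A ∈ l
  · obtain ⟨B, hB, hBA⟩ := exists_ne_mem hl A
    obtain ⟨D, hD⟩ := exists_not_mem hl
    obtain ⟨E, -, -, hE⟩ := exists_orth_of_mem hl hA hD hBA
    have o := hE B hB hBA
    obtain ⟨n, hn, hAn, hEn⟩ := exists_line o.ne_left.symm
    exact ⟨A, hA, n, o.perp hl hn hA hB hAn hEn, hAn, hAn⟩
  · obtain ⟨N, hN, ho⟩ := exists_orth_of_not_mem hl hA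
    obtain ⟨B, hB, hBN⟩ := exists_ne_mem hl N
    have o := ho B hB hBN
    obtain ⟨n, hn, hNn, hAn⟩ := exists_line o.ne_left.symm
    exact ⟨N, hN, n, o.perp hl hn hN hB hNn hAn, hAn, hNn⟩

theorem _root_.PlaneGeometry.IsFoot.eq_of_mem {l : Set P} {A F : P} (h : IsFoot A l F) (hA : A ∈ l) : F = A := by
  obtain ⟨hF, n, hn, hAn, hFn⟩ := h
  exact hn.eq_of_mem hF hFn hA hAn

theorem _root_.PlaneGeometry.IsFoot.orth {l : Set P} {A F B : P} (h : IsFoot A l F) (hA : A ∉ l) (hB : B ∈ l)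
    (hBF : B ≠ F) : Orth A F B := by
  obtain ⟨hF, n, hn, hAn, hFn⟩ := h
  exact hn.orth hF hFn hB hBF hAn (by rintro rfl; exact hA hF)

theorem Orth.isFoot {l : Set P} (hl : l ∈ lines) {A F B : P} (h : Orth A F B) (hF : F ∈ l)
    (hB : B ∈ l) : IsFoot A l F := by
  obtain ⟨n, hn, hNn, hAn⟩ := exists_line h.ne_left.symm
  exact ⟨hF, n, h.perp hl hn hF hB hNn hAn, hAn, hNn⟩

theorem _root_.PlaneGeometry.IsFoot.unique {l : Set P} (hl : l ∈ lines) {A F G : P} (h : IsFoot A l F)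
    (h' : IsFoot A l G) : F = G := by
  by_cases hA : A ∈ l
  · rw [h.eq_of_mem hA, h'.eq_of_mem hA]
  · by_contra hFG
    exact not_right_right hl h.1 h'.1 hFG hA (h.orth hA h'.1 (Ne.symm hFG)).isRightAngle
      (h'.orth hA h.1 hFG).isRightAngle

/-! ### Congruent triangles -/

/-- If two points of a line have the same distances from `A` as their images have from `A'`,
then so have all points of the line. -/
theorem len_isometry {L L' : OrderedLine P} (φ : L.carrier ≃o L'.carrier)
    (hφ : ∀ a b : L.carrier, len (a : P) b = len (φ a : P) (φ b)) {A A' : P}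
    (hA : A ∉ L.carrier) (hA' : A' ∉ L'.carrier) {b c : L.carrier} (hbc : b ≠ c)
    (h₁ : len (b : P) A = len (φ b : P) A') (h₂ : len (c : P) A = len (φ c : P) A')
    (d : L.carrier) : len (d : P) A = len (φ d : P) A' := by
  obtain ⟨N, hN, ho⟩ := exists_orth_of_not_mem L.isLine hA
  lift N to L.carrier using hN
  have hNA : (N : P) ≠ A := by rintro rfl; exact hA N.2
  -- `E` copies `A` over the image of its foot. Right triangles give it the expected distances from
  -- all points, and two of these identify it with `A'`.
  obtain ⟨E, hE, hlen, hoE⟩ := exists_orth_of_mem L'.isLine (φ N).2 hA' hNA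
  have key : ∀ x : L.carrier, len (x : P) A = len (φ x : P) E := by
    intro x
    by_cases hx : x = N
    · rw [hx, hlen]
    · have hx' : φ x ≠ φ N := fun k => hx (φ.injective k)
      rw [len_comm, len_comm _ E]
      exact len_hyp_of_right (ho x x.2 (OrderedLine.coe_ne hx)).isRightAngle
        (hoE _ (φ x).2 (OrderedLine.coe_ne hx')).isRightAngle hlen.symm (hφ N x)
  have : E = A' := eq_of_sameSide L'.isLine (φ b).2 (φ c).2
    (OrderedLine.coe_ne fun k => hbc (φ.injective k)) hE
    (by rw [← key, h₁]) (by rw [← key, h₂])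
  rw [key, this]

theorem exists_lineIsometry {l l' : Set P} (hl : l ∈ lines) (hl' : l' ∈ lines) {B C B' C' : P}
    (hB : B ∈ l) (hC : C ∈ l) (hB' : B' ∈ l') (hC' : C' ∈ l') (hBC : B ≠ C)
    (h : len B C = len B' C') : ∃ (L L' : OrderedLine P) (φ : L.carrier ≃o L'.carrier)
      (b c : L.carrier), L.carrier = l ∧ L'.carrier = l' ∧ (b : P) = B ∧ (c : P) = C ∧
        (φ b : P) = B' ∧ (φ c : P) = C' ∧
        ∀ a b : L.carrier, len (a : P) b = len (φ a : P) (φ b) := by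
  obtain ⟨L, b, c, hL, hb, hc, hbc⟩ := exists_orderedLine hl hB hC hBC
  obtain ⟨L', b', c', hL', hb', hc', hbc'⟩ := exists_orderedLine hl' hB' hC' (len_ne h hBC)
  obtain ⟨φ, h1, h2⟩ := OrderedLine.exists_isometry b b'
  refine ⟨L, L', φ, b, c, hL, hL', hb, hc, by rw [h1, hb'], ?_, h2⟩
  rw [← hc', OrderedLine.eq_of_gt_of_len (a := b') (b := φ c) (c := c')
    (h1 ▸ φ.lt_iff_lt.2 hbc) hbc' (by rw [← h1, ← h2, hb, hc, h, h1, hb', hc'])]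

/-- If triangles `ABC` and `A'B'C'` are congruent and `D`, `D'` lie in the same way relative to
`BC`, `B'C'` on the lines of these segments, then `AD` and `A'D'` are congruent. -/
theorem five_segment {l l' : Set P} (hl : l ∈ lines) (hl' : l' ∈ lines) {A B C D A' B' C' D' : P}
    (hA : A ∉ l) (hB : B ∈ l) (hC : C ∈ l) (hD : D ∈ l) (hA' : A' ∉ l') (hB' : B' ∈ l')
    (hC' : C' ∈ l') (hD' : D' ∈ l') (hBC : B ≠ C) (h₁ : len B C = len B' C')
    (h₂ : len B D = len B' D') (h₃ : len C D = len C' D') (h₄ : len B A = len B' A')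
    (h₅ : len C A = len C' A') : len D A = len D' A' := by
  obtain ⟨L, L', φ, b, c, rfl, rfl, rfl, rfl, rfl, rfl, hφ⟩ :=
    exists_lineIsometry hl hl' hB hC hB' hC' hBC h₁
  lift D to L.carrier using hD
  lift D' to L'.carrier using hD'
  have hbc : b ≠ c := fun k => hBC (congrArg _ k)
  -- If `φ D` and `D'` differed, both `φ b` and `φ c` would be equidistant from them, hence equal.
  have : (φ D : P) = D' := by
    by_contra k
    exact hbc (φ.injective (Subtype.ext (eq_of_equidistant L'.isLine (φ D).2 D'.2 (φ b).2 (φ c).2 k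
      (by rw [← hφ, h₂]) (by rw [← hφ, h₃]))))
  rw [← this]
  exact len_isometry φ hφ hA hA' hbc h₄ h₅ D

/-! ### Quadrilaterals with three right angles -/

theorem isFoot_self {l : Set P} (hl : l ∈ lines) {A : P} (hA : A ∈ l) : IsFoot A l A := by
  obtain ⟨F, hF⟩ := exists_isFoot hl A
  have := hF.eq_of_mem hA
  rwa [this] at hF

theorem _root_.PlaneGeometry.Perp.isFoot {l n : Set P} (h : Perp l n) {A O : P} (hO : O ∈ l)
    (hOn : O ∈ n) (hA : A ∈ n) : IsFoot A l O := ⟨hO, n, h, hA, hOn⟩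

theorem _root_.PlaneGeometry.Perp.mem_of_isFoot {l m : Set P} (h : Perp l m) {A O : P}
    (hO : O ∈ l) (hOm : O ∈ m) (hA : A ∉ l) (hF : IsFoot A l O) : A ∈ m := by
  obtain ⟨B, hB, hBO⟩ := exists_ne_mem h.1 O
  obtain ⟨C, hC, hCO⟩ := exists_ne_mem h.2.1 O
  exact orth_unique h.1 hO hB (h.orth hO hOm hB hBO hC hCO) (hF.orth hA hB hBO) h.2.1 hOm hC

theorem not_cross_of_not_btw {l p : Set P} (hl : l ∈ lines) (hp : p ∈ lines) {A B U : P}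
    (hA : A ∈ p) (hB : B ∈ p) (hU : U ∈ p) (hUl : U ∈ l) (hAl : A ∉ l) (h : ¬ Btw A U B) :
    ¬ ∃ X ∈ l, Btw A X B := by
  rintro ⟨X, hX, hX'⟩
  have hXp := mem_of_btw_mid hp hX' hA hB
  by_cases hXU : X = U
  · exact h (hXU ▸ hX')
  · exact hAl (line_eq hl hp hXU hX hUl hXp hU ▸ hA)

theorem not_mem_of_mem_ne {l p : Set P} (hl : l ∈ lines) (hp : p ∈ lines) {A B C : P}
    (hA : A ∈ l) (hAp : A ∈ p) (hB : B ∈ p) (hBl : B ∉ l) (hC : C ∈ p) (hCA : C ≠ A) : C ∉ l :=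
  fun k => hBl (line_eq hl hp hCA k hA hC hAp ▸ hB)

theorem not_btw_of_btw {A B C : P} (h : Btw A B C) : ¬ Btw B A C := fun k =>
  btw_unique _ _ _ (btw_symm _ _ _ h) k

/-- The diagonals of a quadrilateral `OFAG` with right angles at `O`, `F` and `G` meet. -/
theorem exists_diagonal_point {l m : Set P} (h : Perp l m) {O A F G : P} (hOl : O ∈ l)
    (hOm : O ∈ m) (hAl : A ∉ l) (hAm : A ∉ m) (hF : IsFoot A l F) (hG : IsFoot A m G)
    (hFO : F ≠ O) (hGO : G ≠ O) : ∃ Z, Btw O Z A ∧ Btw F Z G := by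
  obtain ⟨hl, hm, -⟩ := id h
  obtain ⟨hFl, n, hln, hAn, hFn⟩ := id hF
  obtain ⟨hGm, k, hmk, hAk, hGk⟩ := id hG
  have hn := hln.2.1
  have hk := hmk.2.1
  have hnm : ∀ X, X ∈ n → X ∉ m := fun X hX hXm =>
    hFO ((hln.isFoot hFl hFn hX).unique hl (h.isFoot hOl hOm hXm))
  have hkl : ∀ X, X ∈ k → X ∉ l := fun X hX hXl =>
    hGO ((hmk.isFoot hGm hGk hX).unique hm (h.symm.isFoot hOm hOl hXl))
  have hGl := hkl G hGk
  have hFm := hnm F hFn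
  have hOA : O ≠ A := by rintro rfl; exact hAl hOl
  obtain ⟨p, hp, hOp, hAp⟩ := exists_line hOA
  have hGp : G ∉ p := fun q => hAm (line_eq hp hm hGO q hOp hGm hOm ▸ hAp)
  have hFp : F ∉ p := fun q => hAl (line_eq hp hl hFO q hOp hFl hOl ▸ hAp)
  -- `E` is across the line `OA` from `F`. Showing that `E` and `G` are on the same side of it makes
  -- `FG` cross `OA`.
  obtain ⟨E, hE⟩ := btw_extend F O hFO
  have hE' := btw_distinct _ _ _ hE
  have hEl := mem_of_btw_right hl hE hFl hOl
  have hEO := hE'.2.1.symm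
  have hEm : E ∉ m := not_mem_of_mem_ne hm hl hOm hOl hFl hFm hEl hEO
  have hEp : E ∉ p := not_mem_of_mem_ne hp hl hOp hOl hFl hFp hEl hEO
  obtain ⟨fl, -, -, hfl⟩ := exists_side hl
  obtain ⟨fm, -, -, hfm⟩ := exists_side hm
  obtain ⟨fn, -, -, hfn⟩ := exists_side hn
  obtain ⟨fp, -, -, hfp⟩ := exists_side hp
  have sGA : fl G ↔ fl A := by
    have : ¬ ∃ X ∈ l, Btw G X A := fun ⟨X, hX, hX'⟩ =>
      hkl X (mem_of_btw_mid hk hX' hGk hAk) hX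
    rw [hfl G hGl A hAl] at this
    exact not_not.1 this
  have sFA : fm F ↔ fm A := by
    have : ¬ ∃ X ∈ m, Btw F X A := fun ⟨X, hX, hX'⟩ =>
      hnm X (mem_of_btw_mid hn hX' hFn hAn) hX
    rw [hfm F hFm A hAm] at this
    exact not_not.1 this
  have sOG : fn O ↔ fn G := by
    have : ¬ ∃ X ∈ n, Btw O X G := fun ⟨X, hX, hX'⟩ =>
      hnm X hX (mem_of_btw_mid hm hX' hOm hGm)
    rw [hfn O (fun q => hnm O q hOm) G (fun q => hnm G q hGm)] at this
    exact not_not.1 this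
  have sFE : ¬ (fm F ↔ fm E) := (hfm F hFm E hEm).1 ⟨O, hOm, hE⟩
  have sFEp : ¬ (fp F ↔ fp E) := (hfp F hFp E hEp).1 ⟨O, hOp, hE⟩
  have sEG : fp E ↔ fp G := by
    -- A crossing `W` of `EG` with `OA` lies on the side of `E` with respect to `m`, so `WA` meets
    -- `m`, necessarily at `O`. But `W` and `A` are both on the side of `G` with respect to `l`,
    -- which also contains `O`.
    by_contra hc
    obtain ⟨W, hW, hEWG⟩ := (hfp E hEp G hGp).2 hc
    have hd := btw_distinct _ _ _ hEWG
    obtain ⟨q, hq, hEq, hGq⟩ := exists_line hd.2.2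
    have hWq := mem_of_btw_mid hq hEWG hEq hGq
    have hWm : W ∉ m := not_mem_of_mem_ne hm hq hGm hGq hEq hEm hWq hd.2.1
    have hWl : W ∉ l := not_mem_of_mem_ne hl hq hEl hEq hGq hGl hWq hd.1.symm
    have s1 := not_cross_of_not_btw hm hq hEq hWq hGq hGm hEm
      (fun q => btw_unique _ _ _ hEWG (btw_symm _ _ _ q))
    have s2 := not_cross_of_not_btw hl hq hWq hGq hEq hEl hWl (not_btw_of_btw hEWG)
    rw [hfm E hEm W hWm, not_not] at s1
    rw [hfl W hWl G hGl, not_not] at s2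
    obtain ⟨X, hX, hX'⟩ := (hfm W hWm A hAm).2
      fun k => sFE (sFA.trans (k.symm.trans s1.symm))
    have hXp := mem_of_btw_mid hp hX' hW hAp
    have hXO : X = O := by
      by_contra hXO
      exact hAm (line_eq hm hp hXO hX hOm hXp hOp ▸ hAp)
    exact (hfl W hWl A hAl).1 ⟨O, hOl, hXO ▸ hX'⟩ (s2.trans sGA)
  obtain ⟨Z, hZ, hFZG⟩ := (hfp F hFp G hGp).2 fun k => sFEp (k.trans sEG.symm)
  have hd := btw_distinct _ _ _ hFZG
  obtain ⟨q, hq, hFq, hGq⟩ := exists_line hd.2.2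
  have hZq := mem_of_btw_mid hq hFZG hFq hGq
  have hZm : Z ∉ m := not_mem_of_mem_ne hm hq hGm hGq hFq hFm hZq hd.2.1
  have hGn : G ∉ n := fun q => hnm G q hGm
  have hOn : O ∉ n := fun q => hnm O q hOm
  have hZn : Z ∉ n := not_mem_of_mem_ne hn hq hFn hFq hGq hGn hZq hd.1.symm
  have s1 := not_cross_of_not_btw hm hq hFq hZq hGq hGm hFm
    (fun q => btw_unique _ _ _ hFZG (btw_symm _ _ _ q))
  have s2 := not_cross_of_not_btw hn hq hZq hGq hFq hFn hZn (not_btw_of_btw hFZG)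
  rw [hfm F hFm Z hZm, not_not] at s1
  rw [hfn Z hZn G hGn, not_not] at s2
  refine ⟨Z, ?_, hFZG⟩
  -- `Z` is on the side of `A` with respect to `m` and on the side of `O` with respect to `n`, so it
  -- cannot lie beyond `O` or beyond `A`.
  rcases btw_total_of_mem hp hOp hZ hAp (by rintro rfl; exact hZm hOm)
    (by rintro rfl; exact hZn hAn) hOA with h1 | h1 | h1
  · exact h1
  · exact ((hfn Z hZn O hOn).1 ⟨A, hAn, h1⟩ (s2.trans sOG.symm)).elim
  · exact ((hfm A hAm Z hZm).1 ⟨O, hOm, h1⟩ (sFA.symm.trans s1)).elim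

/-- Reflect `B` in `M` and `B'` in `M'`. The five-segment property carries the equidistance of `A`
over to `A'`. -/
theorem Orth.of_len {l' : Set P} (hl' : l' ∈ lines) {A M B A' M' B' : P} (h : Orth A M B)
    (hM' : M' ∈ l') (hB' : B' ∈ l') (hA' : A' ∉ l') (h₁ : len M B = len M' B')
    (h₂ : len M A = len M' A') (h₃ : len B A = len B' A') : Orth A' M' B' := by
  have hBM := h.ne
  obtain ⟨l, hl, hM, hB, hA, C, h4, h5, h6⟩ := h
  have hB'M' : B' ≠ M' := (len_ne h₁ hBM.symm).symm
  obtain ⟨C', hC', -, -, h7, h8⟩ := exists_reflection hl' hB'M' hM' hB'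
  have h9 : len M C = len M' C' := by rw [← h5, h₁, h8]
  have := five_segment hl hl' hA hM hB (mem_of_btw_right hl h4 hB hM) hA' hM' hB' hC' hBM.symm
    h₁ h9 (len_add h4 h7 (by rw [len_comm, h₁, len_comm]) h9) h₂ h₃
  exact orth_of_equidistant hl' hB' hC' hA' h7 h8
    (by rw [len_comm, ← h₃, len_comm, h6, len_comm, this, len_comm])

/-- The degenerate case, in which no quadrilateral exists: the point is on an axis and its foot on
the other axis is the origin. -/
theorem exists_isFoot_of_len_aux {l m l' m' : Set P} (h : Perp l m) (h' : Perp l' m')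
    {O O' A G F' G' : P} (hOl : O ∈ l) (hOm : O ∈ m) (hOl' : O' ∈ l') (hOm' : O' ∈ m')
    (hG : IsFoot A m G) (hF' : F' ∈ l')
    (h₂ : len O G = len O' G') (hA : A ∈ l) :
    ∃ A', IsFoot A' l' F' ∧ IsFoot A' m' G' := by
  have : G = O := hG.unique h.2.1 (h.symm.isFoot hOm hOl hA)
  subst this
  have : O' = G' := eq_of_len_self h₂
  subst this
  exact ⟨F', isFoot_self h'.1 hF', h'.symm.isFoot hOm' hOl' hF'⟩

/-- Points with corresponding feet on two pairs of perpendicular lines. -/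
theorem exists_isFoot_of_len {l m l' m' : Set P} (h : Perp l m) (h' : Perp l' m')
    {O O' A F G F' G' : P} (hOl : O ∈ l) (hOm : O ∈ m) (hOl' : O' ∈ l') (hOm' : O' ∈ m')
    (hF : IsFoot A l F) (hG : IsFoot A m G) (hF' : F' ∈ l') (hG' : G' ∈ m')
    (h₁ : len O F = len O' F') (h₂ : len O G = len O' G') :
    ∃ A', IsFoot A' l' F' ∧ IsFoot A' m' G' := by
  by_cases hAl : A ∈ l
  · exact exists_isFoot_of_len_aux h h' hOl hOm hOl' hOm' hG hF' h₂ hAl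
  by_cases hAm : A ∈ m
  · obtain ⟨A', h3, h4⟩ :=
      exists_isFoot_of_len_aux h.symm h'.symm hOm hOl hOm' hOl' hF hG' h₁ hAm
    exact ⟨A', h4, h3⟩
  have hFO : F ≠ O := fun e => hAm (h.mem_of_isFoot hOl hOm hAl (e ▸ hF))
  have hGO : G ≠ O := fun e => hAl (h.symm.mem_of_isFoot hOm hOl hAm (e ▸ hG))
  have hFO' : F' ≠ O' := (len_ne h₁ hFO.symm).symm
  have hGO' : G' ≠ O' := (len_ne h₂ hGO.symm).symm
  obtain ⟨Z, hZ, hZ'⟩ := exists_diagonal_point h hOl hOm hAl hAm hF hG hFO hGO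
  obtain ⟨hl, hm, -⟩ := id h
  obtain ⟨hl', hm', -⟩ := id h'
  have oO := h.orth hOl hOm hF.1 hFO hG.1 hGO
  have oO' := h'.orth hOl' hOm' hF' hFO' hG' hGO'
  have hFG : len F G = len F' G' :=
    len_hyp_of_right oO.isRightAngle.symm oO'.isRightAngle.symm h₁ h₂
  have hGl := oO.not_mem hl hOl hF.1
  have hGl' := oO'.not_mem hl' hOl' hF'
  have hFm := oO.symm.not_mem hm hOm hG.1
  have hFm' := oO'.symm.not_mem hm' hOm' hG'
  have hd := btw_distinct _ _ _ hZ'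
  obtain ⟨q, hq, hFq, hGq⟩ := exists_line hd.2.2
  obtain ⟨q', hq', hFq', hGq'⟩ := exists_line (len_ne hFG hd.2.2)
  have hOq : O ∉ q := fun k => hGl (line_eq hl hq hFO hF.1 hOl hFq k ▸ hGq)
  have hOq' : O' ∉ q' := fun k => hGl' (line_eq hl' hq' hFO' hF' hOl' hFq' k ▸ hGq')
  -- the point of `F'G'` corresponding to the intersection of the diagonals
  obtain ⟨Z', hZF', e1, e2, e3⟩ : ∃ Z', Btw F' Z' G' ∧ len F Z = len F' Z' ∧
      len G Z = len G' Z' ∧ len Z O = len Z' O' := by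
    obtain ⟨L, L', φ, f, g, rfl, rfl, rfl, rfl, rfl, rfl, hφ⟩ :=
      exists_lineIsometry hq hq' hFq hGq hFq' hGq' hd.2.2 hFG
    have hZL := mem_of_btw_mid hq hZ' hFq hGq
    lift Z to L.carrier using hZL
    refine ⟨φ Z, ?_, hφ f Z, hφ g Z, len_isometry φ hφ hOq hOq' (fun k => hd.2.2 (congrArg _ k))
      ?_ ?_ Z⟩
    · rw [L'.btw_iff]
      simpa only [φ.lt_iff_lt] using (L.btw_iff _ _ _).1 hZ'
    · rw [len_comm, h₁, len_comm]
    · rw [len_comm, h₂, len_comm]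
  have hd' := btw_distinct _ _ _ hZF'
  have hZq' := mem_of_btw_mid hq' hZF' hFq' hGq'
  have hOZ' : O' ≠ Z' := by rintro rfl; exact hOq' hZq'
  -- `A'` is found on the diagonal from `O'`, so no intersection of perpendiculars has to be
  -- assumed.
  obtain ⟨A', hA', e4⟩ := exists_btw_len hOZ' (btw_distinct _ _ _ hZ).2.1
  have hdA := btw_distinct _ _ _ hZ
  have hdA' := btw_distinct _ _ _ hA'
  have e5 : len O A = len O' A' := len_add hZ hA' (by rw [len_comm, e3, len_comm]) e4.symm
  obtain ⟨p, hp, hOp, hZp⟩ := exists_line hdA.1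
  obtain ⟨p', hp', hOp', hZp'⟩ := exists_line hOZ'
  have hAp := mem_of_btw_right hp hZ hOp hZp
  have hAp' := mem_of_btw_right hp' hA' hOp' hZp'
  have hFp : F ∉ p := fun k => hAl (line_eq hl hp hFO hF.1 hOl k hOp ▸ hAp)
  have hGp : G ∉ p := fun k => hAm (line_eq hm hp hGO hG.1 hOm k hOp ▸ hAp)
  have hFp' : F' ∉ p' := fun k => hOq' (line_eq hq' hp' hd'.1 hFq' hZq' k hZp' ▸ hOp')
  have hGp' : G' ∉ p' := fun k =>
    hOq' (line_eq hq' hp' hd'.2.1 hZq' hGq' hZp' k ▸ hOp')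
  have e6 : len A F = len A' F' := five_segment hp hp' hFp hOp hZp hAp hFp' hOp' hZp' hAp' hdA.1
    (by rw [len_comm, e3, len_comm]) e5 e4.symm h₁ (by rw [len_comm, e1, len_comm])
  have e7 : len A G = len A' G' := five_segment hp hp' hGp hOp hZp hAp hGp' hOp' hZp' hAp' hdA.1
    (by rw [len_comm, e3, len_comm]) e5 e4.symm h₂ (by rw [len_comm, e2, len_comm])
  have hAl' : A' ∉ l' := fun k =>
    hFp' (line_eq hl' hp' hdA'.2.2 hOl' k hOp' hAp' ▸ hF')
  have hAm' : A' ∉ m' := fun k =>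
    hGp' (line_eq hm' hp' hdA'.2.2 hOm' k hOp' hAp' ▸ hG')
  refine ⟨A', ((hF.orth hAl hOl hFO.symm).of_len hl' hF' hOl' hAl' ?_ ?_ e5).isFoot hl' hF' hOl',
    ((hG.orth hAm hOm hGO.symm).of_len hm' hG' hOm' hAm' ?_ ?_ e5).isFoot hm' hG' hOm'⟩
  · rw [len_comm, h₁, len_comm]
  · rw [len_comm, e6, len_comm]
  · rw [len_comm, h₂, len_comm]
  · rw [len_comm, e7, len_comm]

/-! ### Signed magnitudes -/

namespace SignedMag

variable {ℓ : OrderedLine P}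

/-- The order isomorphism of the reference line given by a signed magnitude. -/
def toIso (t : SignedMag ℓ) : ℓ.carrier ≃o ℓ.carrier :=
  (Additive.toMul (t : Additive (translations ℓ))).1

theorem len_act (t : SignedMag ℓ) (X Y : ℓ.carrier) :
    len (X : P) Y = len (t.act X : P) (t.act Y) :=
  cong_iff.1 ((Additive.toMul (t : Additive (translations ℓ))).2 X Y)

theorem act_lt (t : SignedMag ℓ) {X Y : ℓ.carrier} : t.act X < t.act Y ↔ X < Y :=
  t.toIso.lt_iff_lt

theorem zero_act (X : ℓ.carrier) : (0 : SignedMag ℓ).act X = X := rfl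

theorem add_act (s t : SignedMag ℓ) (X : ℓ.carrier) : (s + t).act X = s.act (t.act X) := rfl

/-- `t - s` acts as `-s` followed by `t`, so commutativity of `T` is not needed. -/
theorem sub_act (s t : SignedMag ℓ) (X : ℓ.carrier) : (t - s).act (s.act X) = t.act X := by
  rw [← add_act, sub_add_cancel]

theorem eq_of_act_eq {s t : SignedMag ℓ} {X : ℓ.carrier} (h : s.act X = t.act X) : s = t :=
  Subtype.ext (DFunLike.ext _ _ fun Y =>
    OrderedLine.isometry_unique (φ := s.toIso) (ψ := t.toIso) s.len_act t.len_act h Y)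

theorem exists_act_eq (X Y : ℓ.carrier) : ∃ t : SignedMag ℓ, t.act X = Y := by
  obtain ⟨φ, h1, h2⟩ := OrderedLine.exists_isometry X Y
  exact ⟨Additive.ofMul ⟨φ, fun A B => cong_iff.2 (h2 A B)⟩, h1⟩

/-- If the order of `s` and `t` changed between `X` and `Y`, one of the two images of the segment
`XY` would properly contain the other, although both are congruent to it. -/
theorem le_of_act_le {s t : SignedMag ℓ} {X : ℓ.carrier} (h : s.act X ≤ t.act X) : s ≤ t := by
  intro Y
  by_contra! hlt
  rcases lt_trichotomy X Y with hXY | rfl | hXY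
  · exact hlt.ne (OrderedLine.not_len_nested h (t.act_lt.2 hXY) hlt.le
      (by rw [← len_act, ← len_act])).2
  · exact hlt.not_ge h
  · exact hlt.ne (OrderedLine.not_len_nested hlt.le (s.act_lt.2 hXY) h
      (by rw [← len_act, ← len_act])).1

theorem le_iff_act_le {s t : SignedMag ℓ} (X : ℓ.carrier) : s ≤ t ↔ s.act X ≤ t.act X :=
  ⟨fun h => h X, le_of_act_le⟩

theorem lt_iff_act_lt {s t : SignedMag ℓ} (X : ℓ.carrier) : s < t ↔ s.act X < t.act X := by
  rw [lt_iff_le_not_ge, le_iff_act_le X, le_iff_act_le X, ← lt_iff_le_not_ge]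

/-- A translation displaces all points by the same amount. -/
theorem len_displacement (t : SignedMag ℓ) (X Y : ℓ.carrier) :
    len (X : P) (t.act X) = len (Y : P) (t.act Y) := by
  -- the case of a translation in the direction from `X` to `Y`
  have key : ∀ (t : SignedMag ℓ) (X Y : ℓ.carrier), X < Y → X < t.act X →
      len (X : P) (t.act X) = len (Y : P) (t.act Y) := by
    intro t X Y hXY hX
    have hY : Y < t.act Y := by
      have : 0 < t := (lt_iff_act_lt X).2 hX
      exact (lt_iff_act_lt Y).1 this
    have h1 := t.act_lt.2 hXY
    -- If the segments overlap, their common part is added to `XY` and to its translate. If they are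
    -- disjoint, a copy of the first is laid off from `Y` and its end is identified by uniqueness.
    rcases lt_trichotomy Y (t.act X) with h | h | h
    · rw [len_comm (Y : P)]
      exact len_add (OrderedLine.btw_of_lt hXY h) (OrderedLine.btw_of_gt h h1)
        (by rw [t.len_act, len_comm]) (len_comm _ _)
    · rw [← h, len_act t X Y, ← h]
    · obtain ⟨w, hw, hw'⟩ := OrderedLine.exists_gt_len Y (OrderedLine.coe_ne hX.ne)
      have h2 : len (t.act X : P) w = len (Y : P) X :=
        len_add (OrderedLine.btw_of_lt h hw) (OrderedLine.btw_of_gt hX h) (len_comm _ _)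
          (by rw [hw', len_comm])
      have : w = t.act Y := OrderedLine.eq_of_gt_of_len (h.trans hw) h1
        (by rw [h2, ← len_act, len_comm])
      rw [← hw', this]
  have key2 : ∀ (t : SignedMag ℓ) (X Y : ℓ.carrier), X < Y →
      len (X : P) (t.act X) = len (Y : P) (t.act Y) := by
    intro t X Y hXY
    have hneg : ∀ Z, (-t).act (t.act Z) = Z := fun Z => by
      rw [← add_act, neg_add_cancel, zero_act]
    rcases lt_trichotomy X (t.act X) with h | h | h
    · exact key t X Y hXY h
    · have : t = 0 := eq_of_act_eq (X := X) h.symm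
      rw [this, zero_act, zero_act]
      exact len_self _ _
    · have := key (-t) (t.act X) (t.act Y) (t.act_lt.2 hXY) (by rwa [hneg])
      rw [hneg, hneg] at this
      rw [len_comm, this, len_comm]
  rcases lt_trichotomy X Y with h | rfl | h
  · exact key2 t X Y h
  · rfl
  · exact (key2 t Y X h).symm

theorem lt_or_eq_or_gt (s t : SignedMag ℓ) : s < t ∨ s = t ∨ t < s := by
  obtain ⟨X, hX, -⟩ := two_points ℓ.carrier ℓ.isLine
  rcases lt_trichotomy (s.act ⟨X, hX⟩) (t.act ⟨X, hX⟩) with h | h | h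
  · exact Or.inl ((lt_iff_act_lt _).2 h)
  · exact Or.inr (Or.inl (eq_of_act_eq h))
  · exact Or.inr (Or.inr ((lt_iff_act_lt _).2 h))

end SignedMag

/-! ### Coordinatizations -/

theorem isMagnitude_sub {ℓ : OrderedLine P} {s t : SignedMag ℓ} (h : s < t) (X : ℓ.carrier) :
    IsMagnitude (s.act X : P) (t.act X : P) (t - s) := by
  refine ⟨(SignedMag.lt_iff_act_lt (s.act X)).2 ?_, fun Y => cong_iff.2 ?_⟩
  · rw [SignedMag.sub_act, SignedMag.zero_act]
    exact (SignedMag.lt_iff_act_lt X).1 h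
  · rw [SignedMag.len_displacement _ Y (s.act X), SignedMag.sub_act]

/-- The orbit map of a point of `ℓ` identifies `T` with `ℓ`, because translations act simply
transitively; an isometry carries `ℓ` to `l`. -/
theorem nonempty_coordinatization (ℓ l : OrderedLine P) {O : P} (hO : O ∈ l.carrier) :
    Nonempty (Coordinatization ℓ l O) := by
  obtain ⟨X, hX, -⟩ := two_points ℓ.carrier ℓ.isLine
  lift X to ℓ.carrier using hX
  obtain ⟨φ, h1, h2⟩ := OrderedLine.exists_isometry X (⟨O, hO⟩ : l.carrier)
  let e : SignedMag ℓ ≃o ℓ.carrier :=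
    ⟨Equiv.ofBijective (fun t => t.act X)
      ⟨fun _ _ h => SignedMag.eq_of_act_eq h, fun Y => SignedMag.exists_act_eq X Y⟩,
      fun {s t} => (SignedMag.le_iff_act_le X).symm⟩
  refine ⟨⟨e.trans φ, ?_, fun s t hst => ?_⟩⟩
  · change (φ X : P) = O
    rw [h1]
  · refine ⟨(isMagnitude_sub hst X).1, fun Y => cong_iff.2 ?_⟩
    exact (cong_iff.1 ((isMagnitude_sub hst X).2 Y)).trans (h2 _ _)

/-- This links different systems of axes: equal coordinates mean congruent segments from the
respective origins. -/
theorem Coordinatization.len_eq {ℓ l l' : OrderedLine P} {O O' : P} (c : Coordinatization ℓ l O)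
    (c' : Coordinatization ℓ l' O') (t : SignedMag ℓ) :
    len O (c.toPoint t : P) = len O' (c'.toPoint t : P) := by
  obtain ⟨X, hX, -⟩ := two_points ℓ.carrier ℓ.isLine
  suffices h : len (c.toPoint 0 : P) (c.toPoint t) = len (c'.toPoint 0 : P) (c'.toPoint t) by
    rwa [c.map_zero, c'.map_zero] at h
  rcases SignedMag.lt_or_eq_or_gt 0 t with h | h | h
  · exact (cong_iff.1 ((c.magnitude 0 t h).2 ⟨X, hX⟩)).symm.trans
      (cong_iff.1 ((c'.magnitude 0 t h).2 ⟨X, hX⟩))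
  · rw [← h]
    exact len_self _ _
  · rw [len_comm, len_comm (c'.toPoint 0 : P)]
    exact (cong_iff.1 ((c.magnitude t 0 h).2 ⟨X, hX⟩)).symm.trans
      (cong_iff.1 ((c'.magnitude t 0 h).2 ⟨X, hX⟩))

/-- `HasCoords` only asks for some coordinatizations; their uniqueness makes the coordinates well
defined. -/
theorem Coordinatization.toPoint_eq {ℓ l : OrderedLine P} {O : P} (c c' : Coordinatization ℓ l O)
    (t : SignedMag ℓ) : c.toPoint t = c'.toPoint t := by
  have h0 : c.toPoint 0 = c'.toPoint 0 := Subtype.ext (c.map_zero.trans c'.map_zero.symm)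
  have h : len (c.toPoint 0 : P) (c.toPoint t) = len (c.toPoint 0 : P) (c'.toPoint t) := by
    rw [c.map_zero]
    exact c.len_eq c' t
  rcases SignedMag.lt_or_eq_or_gt 0 t with k | k | k
  · exact OrderedLine.eq_of_gt_of_len (c.toPoint.lt_iff_lt.2 k)
      (h0 ▸ c'.toPoint.lt_iff_lt.2 k) h
  · rw [← k, h0]
  · exact OrderedLine.eq_of_lt_of_len (c.toPoint.lt_iff_lt.2 k)
      (h0 ▸ c'.toPoint.lt_iff_lt.2 k) h

theorem Axes.existsUnique_hasCoords (ℓ : OrderedLine P) (S : Axes P) (A : P) :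
    ∃! p : SignedMag ℓ × SignedMag ℓ, S.HasCoords ℓ A p := by
  obtain ⟨c⟩ := nonempty_coordinatization ℓ S.l S.origin_mem_l
  obtain ⟨d⟩ := nonempty_coordinatization ℓ S.m S.origin_mem_m
  obtain ⟨F, hF⟩ := exists_isFoot S.l.isLine A
  obtain ⟨G, hG⟩ := exists_isFoot S.m.isLine A
  refine ⟨(c.toPoint.symm ⟨F, hF.1⟩, d.toPoint.symm ⟨G, hG.1⟩), ⟨c, d, ?_, ?_⟩, ?_⟩
  · rwa [c.toPoint.apply_symm_apply]
  · rwa [d.toPoint.apply_symm_apply]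
  · rintro ⟨s, t⟩ ⟨c', d', h1, h2⟩
    have e1 : c.toPoint s = ⟨F, hF.1⟩ := by
      rw [c.toPoint_eq c']
      exact Subtype.ext (h1.unique S.l.isLine hF)
    have e2 : d.toPoint t = ⟨G, hG.1⟩ := by
      rw [d.toPoint_eq d']
      exact Subtype.ext (h2.unique S.m.isLine hG)
    rw [← e1, ← e2, c.toPoint.symm_apply_apply, d.toPoint.symm_apply_apply]

theorem Axes.coordSet_subset (ℓ : OrderedLine P) (S S' : Axes P) :
    S.coordSet ℓ ⊆ S'.coordSet ℓ := by
  rintro p ⟨A, c, d, h1, h2⟩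
  obtain ⟨c'⟩ := nonempty_coordinatization ℓ S'.l S'.origin_mem_l
  obtain ⟨d'⟩ := nonempty_coordinatization ℓ S'.m S'.origin_mem_m
  obtain ⟨A', h3, h4⟩ := exists_isFoot_of_len S.perp S'.perp S.origin_mem_l S.origin_mem_m
    S'.origin_mem_l S'.origin_mem_m h1 h2 (c'.toPoint p.1).2 (d'.toPoint p.2).2
    (c.len_eq c' p.1) (d.len_eq d' p.2)
  exact ⟨A', c', d', h3, h4⟩

end AbsolutePlane

theorem mainTheorem7 {P : Type*} [AbsolutePlane P] (ℓ : AbsolutePlane.OrderedLine P) :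
    (∀ (S : AbsolutePlane.Axes P) (A : P),
        ∃! p : AbsolutePlane.SignedMag ℓ × AbsolutePlane.SignedMag ℓ, S.HasCoords ℓ A p) ∧
      ∀ S S' : AbsolutePlane.Axes P, S.coordSet ℓ = S'.coordSet ℓ :=
  ⟨AbsolutePlane.Axes.existsUnique_hasCoords ℓ, fun S S' =>
    (AbsolutePlane.Axes.coordSet_subset ℓ S S').antisymm
      (AbsolutePlane.Axes.coordSet_subset ℓ S' S)⟩
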